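/- Let $K$ be an algebraic function field of one variable with full constant field $\mathbb{F}_q$, let $\infty$ be a place of $K$, and let $A\subset K$ be the ring of elements that are integral outside $\infty$. Let $K_\infty$ be the completion of $K$ at $\infty$, with valuation ring $\mathcal{O}_\infty$, let $C_\infty$ be the completion of an algebraic closure of $K_\infty$, with its absolute value $|\cdot|$, and let $\Omega=C_\infty\setminus K_\infty$. The group $GL_2(K_\infty)$, and hence $G=GL_2(A)$, acts on $\Omega$ by $\begin{pmatrix}a&b\\c&d\end{pmatrix}(\omega)=\frac{a\omega+b}{c\omega+d}$; two elements of $\Omega$ are $G$-equivalent if they lie in the same $G$-orbit. An element $\omega\in\Omega$ is elliptic if its stabilizer $G_\omega$ in $G$ contains a non-scalar matrix. Let $\mathcal{T}$ be the Bruhat–Tits tree of $GL_2(K_\infty)$; its vertices are the homothety classes of $\mathcal{O}_\infty$-lattices of rank $2$ in $K_\infty\oplus K_\infty$ (row vectors), with $g\cdot[L]=[Lg^{-1}]$, and the points of its realization are the norms on $K_\infty\oplus K_\infty$ up to positive real factors, the vertex $[L]$ being the class of the norm $x\mapsto\inf\{|c| : c\in K_\infty,\ x\in cL\}$. The building map $\lambda$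 sends $\omega\in\Omega$ to the class of the norm $(u,v)\mapsto|u\omega+v|$; it is $GL_2(K_\infty)$-equivariant. Let $G_v$ be the stabilizer in $G$ of a vertex $v$. The conjugate of an element $a+\varepsilon b$ of $\mathbb{F}_{q^2}K\subset C_\infty$, with $a,b\in K$ and $\varepsilon\in\mathbb{F}_{q^2}\setminus\mathbb{F}_q$, is $a+\varepsilon^q b$. Proposition 3.4 (Theorem B(b)). Let $\omega\in\Omega$ be elliptic. Then $\omega$ lies in $\mathbb{F}_{q^2}K$ and has a well-defined conjugate $\overline\omega\in\Omega$, and $\lambda(\omega)$ is a vertex $v$ of $\mathcal{T}$, unique as such. Moreover: (i) If $\omega$ and $\overline\omega$ are not $G$-equivalent, then $G_v=G_\omega\cong\mathbb{F}_{q^2}^*$, and $|G_v|=q^2-1$. (ii) If $\omega$ and $\overline\omega$ are $G$-equivalent, then $G_v\cong GL_2(\mathbb{F}_q)$, and $|G_v|=q(q-1)^2(q+1)$. -/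

import Mathlib

open scoped NNReal WithZero Pointwise MatrixGroups

noncomputable section

namespace DrinfeldModular

/-! ### The upper half-plane `C ∖ F` and the action of `GL₂(F)` by fractional linear maps -/

section HalfPlane

variable (F C : Type*) [NontriviallyNormedField F] [NormedField C] [NormedAlgebra F C]

/-- Drinfeld's upper half-plane `C ∖ F`, for a field extension `C` of `F`. -/
def HalfPlane : Type _ := {z : C // z ∉ Set.range (algebraMap F C)}

variable {F C}

/-- The underlying element of `C`. -/
def HalfPlane.val (z : HalfPlane F C) : C := Subtype.val z

theorem HalfPlane.ext {z w : HalfPlane F C} (h : z.val = w.val) : z = w := Subtype.ext h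

theorem HalfPlane.eq_zero (z : HalfPlane F C) {c d : F}
    (h : algebraMap F C c * z.val + algebraMap F C d = 0) : c = 0 ∧ d = 0 := by
  have hc : c = 0 := by
    by_contra hc
    have hc' : algebraMap F C c ≠ 0 := by simpa using hc
    refine z.2 ⟨-d / c, ?_⟩
    rw [map_div₀, map_neg, div_eq_iff hc']
    change _ = z.val * _
    linear_combination -h
  subst hc
  simpa using h

theorem HalfPlane.denom_ne_zero (g : GL (Fin 2) F) (z : HalfPlane F C) :
    algebraMap F C (g 1 0) * z.val + algebraMap F C (g 1 1) ≠ 0 := by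
  intro h
  obtain ⟨h0, h1⟩ := z.eq_zero h
  apply g.det_ne_zero
  rw [Matrix.det_fin_two]
  simp [h0, h1]

/-- `GL₂(F)` acts on `C ∖ F` by `g(z) = (a z + b) / (c z + d)`. -/
instance HalfPlane.instSMul : SMul (GL (Fin 2) F) (HalfPlane F C) where
  smul g z :=
    ⟨(algebraMap F C (g 0 0) * z.val + algebraMap F C (g 0 1)) /
      (algebraMap F C (g 1 0) * z.val + algebraMap F C (g 1 1)), by
      rintro ⟨k, hk⟩
      rw [eq_div_iff (z.denom_ne_zero g)] at hk
      have h : algebraMap F C (g 0 0 - k * g 1 0) * z.val +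
          algebraMap F C (g 0 1 - k * g 1 1) = 0 := by
        simp only [map_sub, map_mul]
        linear_combination -hk
      obtain ⟨h0, h1⟩ := z.eq_zero h
      apply g.det_ne_zero
      rw [Matrix.det_fin_two]
      linear_combination (g 1 1) * h0 - (g 1 0) * h1⟩

theorem HalfPlane.smul_val (g : GL (Fin 2) F) (z : HalfPlane F C) :
    (g • z).val = (algebraMap F C (g 0 0) * z.val + algebraMap F C (g 0 1)) /
      (algebraMap F C (g 1 0) * z.val + algebraMap F C (g 1 1)) := rfl

instance HalfPlane.instMulAction : MulAction (GL (Fin 2) F) (HalfPlane F C) where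
  one_smul z := by
    apply HalfPlane.ext
    rw [HalfPlane.smul_val]
    simp
  mul_smul g h z := by
    apply HalfPlane.ext
    have h1 := z.denom_ne_zero h
    have h2 := z.denom_ne_zero (g * h)
    have h3 := (h • z).denom_ne_zero g
    rw [HalfPlane.smul_val, HalfPlane.smul_val g, div_eq_div_iff h2 h3, HalfPlane.smul_val h]
    simp only [Units.val_mul, Matrix.mul_apply, Fin.sum_univ_two, map_add, map_mul]
    field_simp
    ring

end HalfPlane

/-! ### The Bruhat-Tits tree of `GL₂(F)`

The elements of `F ⊕ F` are treated as row vectors. -/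

/-- Right multiplication of row vectors by `g⁻¹`. -/
def rowMap {F : Type*} [Field F] (g : GL (Fin 2) F) : (Fin 2 → F) →ₗ[F] (Fin 2 → F) :=
  Matrix.vecMulLinear (g⁻¹ : GL (Fin 2) F).val

theorem rowMap_apply {F : Type*} [Field F] (g : GL (Fin 2) F) (x : Fin 2 → F) :
    rowMap g x = Matrix.vecMul x (g⁻¹ : GL (Fin 2) F).val := rfl

theorem rowMap_surjective {F : Type*} [Field F] (g : GL (Fin 2) F) : Function.Surjective (rowMap g) := fun x =>
  ⟨Matrix.vecMul x g.val, by
    rw [rowMap_apply, Matrix.vecMul_vecMul, ← Units.val_mul, mul_inv_cancel]; simp⟩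

section Tree

variable (F : Type*) [NontriviallyNormedField F] [IsUltrametricDist F]

/-- The valuation ring `{x | ‖x‖ ≤ 1}` of `F`. -/
abbrev Integers : Subring F := (NormedField.valuation (K := F)).integer

/-- Lattices of rank two: finitely generated modules over the valuation ring in `F ⊕ F` that
span `F ⊕ F` over `F`. -/
structure OLattice where
  carrier : Submodule (Integers F) (Fin 2 → F)
  isLattice : carrier.IsLattice F

variable {F}

theorem OLattice.ext {L M : OLattice F} (h : L.carrier = M.carrier) : L = M := by
  cases L; cases M; cases h; rfl

/-- `GL₂(F)` acts on lattices by `g • L = L g⁻¹`. This is the action for which the building map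
below is equivariant. -/
instance OLattice.instSMul : SMul (GL (Fin 2) F) (OLattice F) where
  smul g L :=
    ⟨L.carrier.map ((rowMap g).restrictScalars (Integers F)),
      { fg := L.isLattice.fg.map _
        span_eq_top := by
          have h := L.isLattice.span_eq_top
          rw [Submodule.map_coe]
          change Submodule.span F (rowMap g '' _) = ⊤
          rw [Submodule.span_image, h, Submodule.map_top, LinearMap.range_eq_top]
          exact rowMap_surjective g }⟩

theorem OLattice.mem_smul {g : GL (Fin 2) F} {L : OLattice F} {x : Fin 2 → F} :
    x ∈ (g • L).carrier ↔ Matrix.vecMul x g.val ∈ L.carrier := by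
  change x ∈ L.carrier.map ((rowMap g).restrictScalars (Integers F)) ↔ _
  rw [Submodule.mem_map]
  constructor
  · rintro ⟨y, hy, rfl⟩
    rw [LinearMap.restrictScalars_apply, rowMap_apply, Matrix.vecMul_vecMul, ← Units.val_mul,
      inv_mul_cancel]
    simpa using hy
  · intro h
    refine ⟨_, h, ?_⟩
    rw [LinearMap.restrictScalars_apply, rowMap_apply, Matrix.vecMul_vecMul, ← Units.val_mul,
      mul_inv_cancel]
    simp

instance OLattice.instMulAction : MulAction (GL (Fin 2) F) (OLattice F) where
  one_smul L := by
    apply OLattice.ext; ext x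
    rw [OLattice.mem_smul]; simp
  mul_smul g h L := by
    apply OLattice.ext; ext x
    rw [OLattice.mem_smul, OLattice.mem_smul, OLattice.mem_smul, Matrix.vecMul_vecMul, Units.val_mul]

variable (F) in
/-- Homothety of lattices: `L' = c L` for some nonzero `c` in `F`. -/
def OLattice.homothety : Setoid (OLattice F) where
  r L L' := ∃ c : F, c ≠ 0 ∧ ∀ x, c • x ∈ L'.carrier ↔ x ∈ L.carrier
  iseqv :=
    { refl := fun L => ⟨1, one_ne_zero, fun x => by rw [one_smul]⟩
      symm := by
        rintro L L' ⟨c, hc, h⟩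
        exact ⟨c⁻¹, inv_ne_zero hc, fun x => by rw [← h, smul_inv_smul₀ hc]⟩
      trans := by
        rintro L L' L'' ⟨c, hc, h⟩ ⟨d, hd, h'⟩
        exact ⟨d * c, mul_ne_zero hd hc, fun x => by rw [mul_smul, h', h]⟩ }

variable (F) in
/-- The vertices of the Bruhat-Tits tree: homothety classes of lattices in `F ⊕ F`. -/
def Vertex : Type _ := Quotient (OLattice.homothety F)

/-- The class of a lattice. -/
def Vertex.mk (L : OLattice F) : Vertex F := Quotient.mk (OLattice.homothety F) L

theorem OLattice.homothety_smul (g : GL (Fin 2) F) {L L' : OLattice F}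
    (h : OLattice.homothety F L L') : OLattice.homothety F (g • L) (g • L') := by
  obtain ⟨c, hc, h⟩ := h
  refine ⟨c, hc, fun x => ?_⟩
  rw [OLattice.mem_smul, OLattice.mem_smul, Matrix.smul_vecMul, h]

/-- The action of `GL₂(F)` on the vertices of its tree. -/
instance Vertex.instMulAction : MulAction (GL (Fin 2) F) (Vertex F) where
  smul g := Quotient.map (fun L => g • L) (fun _ _ h => OLattice.homothety_smul g h)
  one_smul v := Quotient.inductionOn v fun L => congrArg Vertex.mk (one_smul _ L)
  mul_smul g h v := Quotient.inductionOn v fun L => congrArg Vertex.mk (mul_smul g h L)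

variable (F) in
/-- (Non-archimedean) norms on the vector space `F ⊕ F`. -/
structure VecNorm where
  toFun : (Fin 2 → F) → ℝ
  eq_zero : ∀ x, toFun x = 0 → x = 0
  map_smul : ∀ (c : F) x, toFun (c • x) = ‖c‖ * toFun x
  map_add_le : ∀ x y, toFun (x + y) ≤ max (toFun x) (toFun y)

variable (F) in
/-- Two norms are equivalent if they agree up to a positive real factor. -/
def VecNorm.homothety : Setoid (VecNorm F) where
  r N N' := ∃ r : ℝ, 0 < r ∧ ∀ x, N'.toFun x = r * N.toFun x
  iseqv :=
    { refl := fun N => ⟨1, one_pos, fun x => by rw [one_mul]⟩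
      symm := by
        rintro N N' ⟨r, hr, h⟩
        exact ⟨r⁻¹, inv_pos.2 hr, fun x => by rw [h, inv_mul_cancel_left₀ hr.ne']⟩
      trans := by
        rintro N N' N'' ⟨r, hr, h⟩ ⟨s, hs, h'⟩
        exact ⟨s * r, mul_pos hs hr, fun x => by rw [h', h, mul_assoc]⟩ }

variable (F) in
/-- The points of the (geometric realization of the) Bruhat-Tits tree, in the description of
Goldman and Iwahori: norms on `F ⊕ F` up to positive real factors. The norms defined by lattices
are the vertices, and all others lie in the interior of an edge. -/
def TreePoint : Type _ := Quotient (VecNorm.homothety F)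

/-- The class of a norm. -/
def TreePoint.mk (N : VecNorm F) : TreePoint F := Quotient.mk (VecNorm.homothety F) N

/-- The set of all `‖c‖` with `x ∈ c L`. -/
def OLattice.scales (L : OLattice F) (x : Fin 2 → F) : Set ℝ :=
  {r | ∃ c : F, ‖c‖ = r ∧ ∃ y ∈ L.carrier, x = c • y}

theorem OLattice.scales_bddBelow (L : OLattice F) (x : Fin 2 → F) : BddBelow (L.scales x) :=
  ⟨0, by rintro r ⟨c, rfl, -⟩; exact norm_nonneg c⟩

theorem OLattice.mem_of_norm_le (L : OLattice F) {c d : F} (h : ‖c‖ ≤ ‖d‖) {y : Fin 2 → F}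
    (hy : y ∈ L.carrier) : ∃ z ∈ L.carrier, c • y = d • z := by
  by_cases hd : d = 0
  · have hc : c = 0 := by simpa [hd] using h
    exact ⟨y, hy, by rw [hc, hd]⟩
  · have hm : c / d ∈ Integers F := by
      rw [Valuation.mem_integer_iff, NormedField.valuation_apply, ← NNReal.coe_le_coe, coe_nnnorm,
        norm_div, NNReal.coe_one]
      exact div_le_one_of_le₀ h (norm_nonneg _)
    refine ⟨(c / d) • y, L.carrier.smul_mem ⟨c / d, hm⟩ hy, ?_⟩
    rw [smul_smul, mul_div_cancel₀ _ hd]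

theorem OLattice.max_mem_scales (L : OLattice F) {x y : Fin 2 → F} {r s : ℝ}
    (hr : r ∈ L.scales x) (hs : s ∈ L.scales y) : max r s ∈ L.scales (x + y) := by
  obtain ⟨c, rfl, x', hx, rfl⟩ := hr
  obtain ⟨d, rfl, y', hy, rfl⟩ := hs
  rcases le_total ‖c‖ ‖d‖ with h | h
  · obtain ⟨z, hz, e⟩ := L.mem_of_norm_le h hx
    exact ⟨d, (max_eq_right h).symm, z + y', add_mem hz hy, by rw [e, smul_add]⟩
  · obtain ⟨z, hz, e⟩ := L.mem_of_norm_le h hy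
    exact ⟨c, (max_eq_left h).symm, x' + z, add_mem hx hz, by rw [e, smul_add]⟩

theorem OLattice.mul_mem_scales (L : OLattice F) (a : F) {x : Fin 2 → F} {r : ℝ}
    (hr : r ∈ L.scales x) : ‖a‖ * r ∈ L.scales (a • x) := by
  obtain ⟨c, rfl, x', hx, rfl⟩ := hr
  exact ⟨a * c, norm_mul a c, x', hx, smul_smul a c x'⟩

theorem OLattice.scales_nonempty (L : OLattice F) (x : Fin 2 → F) : (L.scales x).Nonempty := by
  have hx : x ∈ Submodule.span F (L.carrier : Set (Fin 2 → F)) := by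
    rw [L.isLattice.span_eq_top]; trivial
  induction hx using Submodule.span_induction with
  | mem x h => exact ⟨_, 1, rfl, x, h, (one_smul _ _).symm⟩
  | zero => exact ⟨_, 0, rfl, 0, zero_mem _, (smul_zero _).symm⟩
  | add x y _ _ h1 h2 =>
    obtain ⟨r, hr⟩ := h1
    obtain ⟨s, hs⟩ := h2
    exact ⟨_, L.max_mem_scales hr hs⟩
  | smul a x _ h =>
    obtain ⟨r, hr⟩ := h
    exact ⟨_, L.mul_mem_scales a hr⟩

theorem OLattice.exists_bound (L : OLattice F) : ∃ B : ℝ, 0 < B ∧ ∀ y ∈ L.carrier, ‖y‖ ≤ B := by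
  obtain ⟨S, hS⟩ := L.isLattice.fg
  refine ⟨1 + ∑ y ∈ S, ‖y‖, by positivity, fun y hy => ?_⟩
  rw [← hS] at hy
  induction hy using Submodule.span_induction with
  | mem x h =>
    have := Finset.single_le_sum (f := fun y : Fin 2 → F => ‖y‖) (fun y _ => norm_nonneg y) h
    linarith
  | zero => rw [norm_zero]; positivity
  | add x y _ _ h1 h2 => exact (IsUltrametricDist.norm_add_le_max x y).trans (max_le h1 h2)
  | smul a x _ h =>
    have ha : ‖(a : F)‖ ≤ 1 := by
      have := a.2
      rw [Valuation.mem_integer_iff, NormedField.valuation_apply, ← NNReal.coe_le_coe, coe_nnnorm,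
        NNReal.coe_one] at this
      exact this
    change ‖(a : F) • x‖ ≤ _
    rw [norm_smul]
    exact (mul_le_of_le_one_left (norm_nonneg _) ha).trans h

theorem OLattice.sInf_scales_smul_le (L : OLattice F) (a : F) (x : Fin 2 → F) :
    sInf (L.scales (a • x)) ≤ ‖a‖ * sInf (L.scales x) := by
  rcases (norm_nonneg a).eq_or_lt with h | h
  · rw [← h, zero_mul]
    obtain ⟨r, hr⟩ := L.scales_nonempty x
    have := csInf_le (L.scales_bddBelow _) (L.mul_mem_scales a hr)
    rwa [← h, zero_mul] at this
  · rw [mul_comm, ← div_le_iff₀ h]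
    refine le_csInf (L.scales_nonempty x) fun r hr => ?_
    rw [div_le_iff₀ h, mul_comm]
    exact csInf_le (L.scales_bddBelow _) (L.mul_mem_scales a hr)

/-- The norm defined by a lattice `L`: the infimum of all `‖c‖` with `x ∈ c L`. -/
def OLattice.norm (L : OLattice F) : VecNorm F where
  toFun x := sInf (L.scales x)
  eq_zero x hx := by
    obtain ⟨B, hB, h⟩ := L.exists_bound
    have : ‖x‖ / B ≤ sInf (L.scales x) := by
      refine le_csInf (L.scales_nonempty x) ?_
      rintro r ⟨c, rfl, y, hy, rfl⟩
      rw [div_le_iff₀ hB, norm_smul]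
      exact mul_le_mul_of_nonneg_left (h y hy) (norm_nonneg c)
    rw [hx, div_le_iff₀ hB, zero_mul] at this
    exact norm_le_zero_iff.1 this
  map_smul c x := by
    refine le_antisymm (L.sInf_scales_smul_le c x) ?_
    by_cases hc : c = 0
    · rw [hc, norm_zero, zero_mul]
      exact le_csInf (L.scales_nonempty _) (by rintro r ⟨d, rfl, -⟩; exact norm_nonneg d)
    · have h := L.sInf_scales_smul_le c⁻¹ (c • x)
      rw [inv_smul_smul₀ hc, norm_inv, inv_mul_eq_div, le_div_iff₀ (norm_pos_iff.2 hc)] at h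
      rwa [mul_comm]
  map_add_le x y := by
    refine le_of_forall_pos_le_add fun e he => ?_
    obtain ⟨r, hr, h1⟩ := exists_lt_of_csInf_lt (L.scales_nonempty x) (lt_add_of_pos_right _ he)
    obtain ⟨s, hs, h2⟩ := exists_lt_of_csInf_lt (L.scales_nonempty y) (lt_add_of_pos_right _ he)
    refine (csInf_le (L.scales_bddBelow _) (L.max_mem_scales hr hs)).trans ?_
    rw [← max_add_add_right]
    exact max_le_max h1.le h2.le

theorem OLattice.norm_homothety {L L' : OLattice F} (h : OLattice.homothety F L L') :
    VecNorm.homothety F L.norm L'.norm := by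
  obtain ⟨c, hc, h⟩ := h
  refine ⟨‖c⁻¹‖, norm_pos_iff.2 (inv_ne_zero hc), fun x => ?_⟩
  rw [← L.norm.map_smul]
  change sInf _ = sInf _
  congr 1
  ext r
  constructor
  · rintro ⟨d, rfl, y, hy, rfl⟩
    exact ⟨d, rfl, c⁻¹ • y, (h _).1 (by rwa [smul_inv_smul₀ hc]), smul_comm _ _ _⟩
  · rintro ⟨d, rfl, y, hy, e⟩
    exact ⟨d, rfl, c • y, (h y).2 hy, by rw [smul_comm, ← e, smul_inv_smul₀ hc]⟩

/-- The vertex given by a lattice `L`, as a point of the tree. -/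
def Vertex.toPoint : Vertex F → TreePoint F :=
  Quotient.map OLattice.norm (fun _ _ h => OLattice.norm_homothety h)

variable {C : Type*} [NormedField C] [NormedAlgebra F C] [IsUltrametricDist C]

/-- The norm `(u, v) ↦ ‖u ω + v‖` on `F ⊕ F` defined by `ω ∈ C ∖ F`. -/
def HalfPlane.norm (ω : HalfPlane F C) : VecNorm F where
  toFun x := ‖algebraMap F C (x 0) * ω.val + algebraMap F C (x 1)‖
  eq_zero x hx := by
    obtain ⟨h0, h1⟩ := ω.eq_zero (norm_eq_zero.1 hx)
    ext i
    fin_cases i <;> simpa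
  map_smul c x := by
    rw [← norm_algebraMap' C c, ← norm_mul]
    congr 1
    simp only [Pi.smul_apply, smul_eq_mul, map_mul]
    ring
  map_add_le x y := by
    refine le_trans (le_of_eq ?_) (IsUltrametricDist.norm_add_le_max _ _)
    congr 1
    simp only [Pi.add_apply, map_add]
    ring

/-- The building map from the upper half-plane `C ∖ F` to the tree. -/
def buildingMap (ω : HalfPlane F C) : TreePoint F := TreePoint.mk ω.norm

end Tree

/-! ### Places of a function field and the associated objects -/

/-- A place of `K`, given by its normalized discrete valuation (written multiplicatively). -/
structure Place (K : Type*) [Field K] where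
  valuation : Valuation K ℤᵐ⁰
  surjective : Function.Surjective valuation

namespace Place

variable {K : Type*} [Field K] (P : Place K)

/-- The absolute value `2 ^ (-ν x)` belonging to the place; the choice of the base is immaterial. -/
def abs : AbsoluteValue K ℝ where
  toFun x := (WithZeroMulInt.toNNReal (two_ne_zero : (2 : ℝ≥0) ≠ 0) (P.valuation x) : ℝ)
  map_mul' x y := by simp
  nonneg' x := NNReal.coe_nonneg _
  eq_zero' x := by simp
  add_le' x y := by
    have hm := (WithZeroMulInt.toNNReal_strictMono (one_lt_two : (1 : ℝ≥0) < 2)).monotone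
    rw [← NNReal.coe_add, NNReal.coe_le_coe]
    refine (hm (P.valuation.map_add x y)).trans ?_
    rw [hm.map_max]
    exact max_le le_self_add le_add_self

/-- The completion of `K` at the place. -/
abbrev Kinf : Type _ := P.abs.Completion

/-- The embedding of `K` into its completion. -/
def toKinf : K →+* P.Kinf :=
  (UniformSpace.Completion.coeRingHom (α := WithAbs P.abs)).comp
    (WithAbs.equiv P.abs).symm.toRingHom

theorem norm_toKinf (x : K) : ‖P.toKinf x‖ = P.abs x := by
  change ‖((WithAbs.toAbs P.abs x : WithAbs P.abs) : P.Kinf)‖ = _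
  rw [UniformSpace.Completion.norm_coe, WithAbs.norm_toAbs_eq]

instance : NontriviallyNormedField P.Kinf :=
  { (inferInstance : NormedField P.Kinf) with
    non_trivial := by
      obtain ⟨x, hx⟩ := P.surjective (WithZero.exp (1 : ℤ))
      refine ⟨P.toKinf x, ?_⟩
      rw [norm_toKinf]
      change (1 : ℝ) < (WithZeroMulInt.toNNReal _ (P.valuation x) : ℝ)
      rw [hx, ← NNReal.coe_one, NNReal.coe_lt_coe,
        ← map_one (WithZeroMulInt.toNNReal (two_ne_zero : (2 : ℝ≥0) ≠ 0))]
      exact WithZeroMulInt.toNNReal_strictMono one_lt_two (by simp [← WithZero.exp_zero]) }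

instance : IsUltrametricDist P.Kinf := by
  rw [isUltrametricDist_iff_forall_norm_natCast_le_one]
  intro n
  rw [← map_natCast P.toKinf, norm_toKinf]
  change (WithZeroMulInt.toNNReal _ (P.valuation n) : ℝ) ≤ 1
  rw [← NNReal.coe_one, NNReal.coe_le_coe,
    ← map_one (WithZeroMulInt.toNNReal (two_ne_zero : (2 : ℝ≥0) ≠ 0))]
  refine (WithZeroMulInt.toNNReal_strictMono one_lt_two).monotone ?_
  induction n with
  | zero => simp
  | succ n ih =>
    rw [Nat.cast_succ]
    exact (P.valuation.map_add _ _).trans (max_le ih (by simp))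

/-- An algebraic closure of the completion. -/
abbrev KinfAlg : Type _ := AlgebraicClosure P.Kinf

/-- The unique extension of the absolute value to the algebraic closure. -/
instance : NormedField P.KinfAlg := spectralNorm.normedField P.Kinf P.KinfAlg

instance : NormedAlgebra P.Kinf P.KinfAlg := spectralNorm.normedAlgebra P.Kinf P.KinfAlg

/-- The completion of an algebraic closure of the completion of `K`. -/
abbrev Cinf : Type _ := UniformSpace.Completion P.KinfAlg

instance : NormedAlgebra P.Kinf P.Cinf := inferInstance

instance : IsUltrametricDist P.Cinf := IsUltrametricDist.of_normedAlgebra P.Kinf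

/-- The embedding of `K` into `C_∞`. -/
def toCinf : K →+* P.Cinf := (algebraMap P.Kinf P.Cinf).comp P.toKinf

/-- The ring `A` of all elements of `K` that are integral outside the place `P`: they lie in every
valuation ring of `K` that is different from the valuation ring of `P`. -/
def ringA : Subring K :=
  ⨅ (O : ValuationSubring K) (_ : O ≠ P.valuation.valuationSubring), O.toSubring

/-- Drinfeld's upper half-plane `Ω = C_∞ ∖ K_∞`. -/
abbrev Omega : Type _ := HalfPlane P.Kinf P.Cinf

/-- The Drinfeld modular group `G = GL₂(A)`. -/
abbrev G : Type _ := GL (Fin 2) P.ringA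

/-- The natural embedding of `G` into `GL₂(K_∞)`. -/
def embG : P.G →* GL (Fin 2) P.Kinf :=
  Matrix.GeneralLinearGroup.map (P.toKinf.comp P.ringA.subtype)

/-- The stabilizer `G_ω` of `ω ∈ Ω`. -/
def pointStabilizer (ω : P.Omega) : Subgroup P.G :=
  (MulAction.stabilizer (GL (Fin 2) P.Kinf) ω).comap P.embG

/-- The stabilizer `G_v` of a vertex `v` of the tree. -/
def vertexStabilizer (v : Vertex P.Kinf) : Subgroup P.G :=
  (MulAction.stabilizer (GL (Fin 2) P.Kinf) v).comap P.embG

/-- `ω₁` and `ω₂` are `G`-equivalent. -/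
def Equivalent (ω₁ ω₂ : P.Omega) : Prop := ∃ g : P.G, ω₁ = P.embG g • ω₂

/-- `ω` is an elliptic element: its stabilizer contains a matrix that is not scalar. -/
def IsElliptic (ω : P.Omega) : Prop :=
  ∃ g ∈ P.pointStabilizer ω, ¬ ∃ a : P.ringA, g.val = Matrix.scalar (Fin 2) a

/-- `ω'` is the conjugate of `ω` under the nontrivial automorphism of `𝔽_{q²} K` over `K`:
`ω = a + ε b` and `ω' = a + ε ^ q b` with `a, b ∈ K` and `ε ∈ 𝔽_{q²} ∖ 𝔽_q`. -/
def IsConjugate (q : ℕ) (ω ω' : P.Omega) : Prop :=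
  ∃ ε : P.Cinf, ε ^ q ^ 2 = ε ∧ ε ^ q ≠ ε ∧ ∃ a b : K,
    ω.val = P.toCinf a + ε * P.toCinf b ∧ ω'.val = P.toCinf a + ε ^ q * P.toCinf b

end Place

end DrinfeldModular

end

/-!
The idea is that of vector bundles on the curve of `K`. Let `q` be the number of constants. The
matrices over `A` that do not increase the norm of `ω` on row vectors are the global endomorphisms
of the rank two bundle given by the module `A ω + A` and its norm at infinity; the stabilizer of
the vertex of `ω` is the unit group of this ring of contractions, because a similitude in `GL₂(A)`
has a unit of `A` as its determinant and is therefore an isometry.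

* An element of `A` without a pole at infinity is a constant, and units of `A` have absolute value
  one, since a transcendental element of `K` has a zero and a pole
  (`exists_valuationSubring_mem_nonunits`).
* The eigenvalue `ε` at `ω` of a nonscalar matrix in the stabilizer is a root of a quadratic
  polynomial over `A` with constant coefficients: the determinant is a unit, and a trace with a
  pole at infinity would put the roots into `K_∞` (`mem_range_of_one_lt_norm_trace`). So
  `ε ^ q ^ 2 = ε`, and `ω` and its conjugate `ω'` are `a + ε b` and `a + ε ^ q b`
  (`exists_ellipticPair`).
* As `ε` is not in `K_∞`, it is not congruent to an element of `K_∞` either, which gives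
  `‖x + ε y‖ = max ‖x‖ ‖y‖` (`norm_add_mul_eq_max`). Hence the norm of `ω` comes from a lattice and
  agrees with the norm of `ω'`.
* Multiplication by `ε` embeds the field `k₂` with `q²` elements into the contractions. Every
  contraction is the sum of one that commutes with `k₂` and one that is semilinear with respect to
  the Frobenius automorphism. The former have eigenvectors `ω` and `ω'`, so trace and determinant
  are constants and they lie in `k₂`. The square of a semilinear one lies in `k₂`, so a nonzero one
  is invertible and maps `ω'` to `ω` (`EllipticPair.exists_structure`).
* Thus the contractions are `k₂` if `ω` and `ω'` are not equivalent. If they are, some semilinear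
  contraction is invertible with its square a constant; as constants are norms from `k₂`, it can be
  scaled to an involution `τ`, and the contractions `k₂ ⊕ k₂ τ` form the split cyclic algebra of
  endomorphisms `y ↦ z y + w y ^ q` of the vector space `k₂` (`units_mulEquiv_GL`).
-/

noncomputable section

namespace DrinfeldModular

/-! ### Finite fields inside a field -/

section FiniteFields

variable {k R : Type*} [Field k] [Fintype k]

theorem exists_frobenius [CommRing R] (h : k →+* R) :
    ∃ φ : R →+* R, ∀ x, φ x = x ^ Fintype.card k := by
  let := h.toAlgebra
  exact ⟨(FiniteField.frobeniusAlgHom k R).toRingHom, fun x => rfl⟩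

/-- The image of a field with `q` elements in a field consists of the solutions of `x ^ q = x`. -/
theorem pow_card_eq_self_iff [Field R] (h : k →+* R) {x : R} :
    x ^ Fintype.card k = x ↔ x ∈ Set.range h := by
  classical
  constructor
  · intro hx
    have hne : (Polynomial.X ^ Fintype.card k - Polynomial.X : Polynomial R) ≠ 0 :=
      FiniteField.X_pow_card_sub_X_ne_zero R Fintype.one_lt_card
    have hcard : (Polynomial.X ^ Fintype.card k - Polynomial.X : Polynomial R).natDegree ≤
        (Finset.univ.image h).card := by
      rw [Finset.card_image_of_injective _ h.injective, Finset.card_univ,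
        FiniteField.X_pow_card_sub_X_natDegree_eq R Fintype.one_lt_card]
    have hsub : Finset.univ.image h ⊆
        (Polynomial.X ^ Fintype.card k - Polynomial.X : Polynomial R).roots.toFinset := by
      intro y hy
      obtain ⟨a, -, rfl⟩ := Finset.mem_image.1 hy
      rw [Multiset.mem_toFinset, Polynomial.mem_roots hne]
      simp [← map_pow, FiniteField.pow_card]
    have hle : (Polynomial.X ^ Fintype.card k - Polynomial.X : Polynomial R).roots.toFinset.card ≤
        (Finset.univ.image h).card :=
      ((Multiset.toFinset_card_le _).trans (Polynomial.card_roots' _)).trans hcard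
    have hmem : x ∈ Finset.univ.image h := by
      rw [Finset.eq_of_subset_of_card_le hsub hle, Multiset.mem_toFinset, Polynomial.mem_roots hne]
      simp [hx]
    obtain ⟨a, -, ha⟩ := Finset.mem_image.1 hmem
    exact ⟨a, ha⟩
  · rintro ⟨a, rfl⟩
    rw [← map_pow, FiniteField.pow_card]

/-- A root of a quadratic polynomial over a field with `q` elements, lying in a larger field, is
either in the image of the small field, or its `q`-th power is the other root. -/
theorem pow_card_eq_other_root [Field R] (h : k →+* R) {t n : k} {x : R}
    (hx : x ^ 2 - h t * x + h n = 0) (hx' : x ∉ Set.range h) :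
    x ^ Fintype.card k = h t - x ∧ (x ^ Fintype.card k) ^ Fintype.card k = x := by
  obtain ⟨φ, hφ⟩ := exists_frobenius h
  have hk : ∀ a, φ (h a) = h a := fun a => by rw [hφ, ← map_pow, FiniteField.pow_card]
  have h1 : φ x ^ 2 - h t * φ x + h n = 0 := by
    have := congrArg φ hx
    simpa [hk] using this
  have h2 : φ x ≠ x := by rwa [hφ, Ne, pow_card_eq_self_iff]
  have h3 : φ x = h t - x := by
    have : (φ x - x) * (φ x - (h t - x)) = 0 := by linear_combination h1 - hx
    rcases mul_eq_zero.1 this with h | h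
    · exact absurd (sub_eq_zero.1 h) h2
    · exact sub_eq_zero.1 h
  refine ⟨by rw [← hφ, h3], ?_⟩
  rw [← hφ, ← hφ, h3, map_sub, hk, h3]
  ring

end FiniteFields

/-! ### Constants of a function field -/

section Constants

variable {k K : Type*} [Field k] [Field K] [Algebra k K]

/-- A transcendental element has a zero. -/
theorem exists_valuationSubring_mem_nonunits {x : K} (hx : ¬ IsAlgebraic k x) :
    ∃ O : ValuationSubring K, x ∈ O.nonunits := by
  let R := (Algebra.adjoin k {x}).toSubring
  let y : R := ⟨x, Algebra.self_mem_adjoin_singleton k x⟩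
  have hI : Ideal.span {y} ≠ ⊤ := by
    intro h
    rw [Ideal.span_singleton_eq_top, isUnit_iff_exists_inv] at h
    obtain ⟨⟨z, hz⟩, h⟩ := h
    have hz' : z ∈ Algebra.adjoin k {x} := hz
    rw [Algebra.adjoin_singleton_eq_range_aeval] at hz'
    obtain ⟨p, rfl⟩ := hz'
    have h' : x * Polynomial.aeval x p = 1 := congrArg Subtype.val h
    apply hx
    refine ⟨Polynomial.X * p - 1, fun h0 => ?_, by simp [h']⟩
    have := congrArg (Polynomial.eval 0) h0
    simp at this
  obtain ⟨O, -, hO⟩ := Ideal.image_subset_nonunits_valuationSubring _ hI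
  exact ⟨O, hO ⟨y, Ideal.subset_span rfl, rfl⟩⟩

theorem exists_valuationSubring_notMem {x : K} (hx : ¬ IsAlgebraic k x) :
    ∃ O : ValuationSubring K, x ∉ O := by
  have hx0 : x ≠ 0 := by rintro rfl; exact hx isAlgebraic_zero
  obtain ⟨O, hO⟩ := exists_valuationSubring_mem_nonunits (k := k) (x := x⁻¹)
    (fun h => hx (by simpa using h.inv))
  refine ⟨O, ?_⟩
  have := O.inv_mem_nonunits_iff.1 hO
  tauto

theorem algebraMap_mem_valuationSubring [Fintype k] (O : ValuationSubring K) (a : k) :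
    algebraMap k K a ∈ O := by
  by_cases ha : a = 0
  · simp [ha, O.zero_mem]
  rcases O.mem_or_inv_mem (algebraMap k K a) with h | h
  · exact h
  · have : algebraMap k K a = (algebraMap k K a)⁻¹ ^ (Fintype.card k - 2) := by
      have h1 : a ^ (Fintype.card k - 1) = 1 := FiniteField.pow_card_sub_one_eq_one a ha
      have h2 : Fintype.card k - 1 = Fintype.card k - 2 + 1 := by
        have := Fintype.one_lt_card (α := k); omega
      rw [h2, pow_succ] at h1
      rw [← map_inv₀, ← map_pow]
      congr 1
      rw [inv_pow]
      exact eq_inv_of_mul_eq_one_right h1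
    rw [this]
    exact pow_mem h _

namespace Place

variable (P : Place K)

theorem mem_ringA {x : K} :
    x ∈ P.ringA ↔ ∀ O : ValuationSubring K, O ≠ P.valuation.valuationSubring → x ∈ O := by
  simp [ringA, Subring.mem_iInf]

theorem abs_apply (x : K) :
    P.abs x = (WithZeroMulInt.toNNReal (two_ne_zero : (2 : ℝ≥0) ≠ 0) (P.valuation x) : ℝ) := rfl

theorem abs_le_one_iff {x : K} : P.abs x ≤ 1 ↔ x ∈ P.valuation.valuationSubring := by
  rw [abs_apply, ← NNReal.coe_one, NNReal.coe_le_coe,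
    ← map_one (WithZeroMulInt.toNNReal (two_ne_zero : (2 : ℝ≥0) ≠ 0)),
    (WithZeroMulInt.toNNReal_strictMono (one_lt_two : (1 : ℝ≥0) < 2)).le_iff_le]
  rfl

/-- Elements of `A` without a pole at infinity are constants. -/
theorem isAlgebraic_of_abs_le_one {a : K} (ha : a ∈ P.ringA) (h : P.abs a ≤ 1) :
    IsAlgebraic k a := by
  by_contra hx
  obtain ⟨O, hO⟩ := exists_valuationSubring_notMem (k := k) hx
  refine hO (P.mem_ringA.1 ha O ?_)
  rintro rfl
  exact hO (P.abs_le_one_iff.1 h)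

theorem abs_eq_one_of_mem_range [Fintype k] {a : K} (h : a ∈ Set.range (algebraMap k K))
    (h0 : a ≠ 0) : P.abs a = 1 := by
  obtain ⟨a, rfl⟩ := h
  have ha : a ≠ 0 := by rintro rfl; simp at h0
  have := congrArg (fun x => P.abs (algebraMap k K x)) (FiniteField.pow_card_sub_one_eq_one a ha)
  simp only [map_pow, map_one] at this
  exact (pow_eq_one_iff_of_nonneg (P.abs.nonneg _)
    (by have := Fintype.one_lt_card (α := k); omega)).1 this

theorem abs_le_one_of_unit [Fintype k]
    (hconst : ∀ x : K, IsAlgebraic k x → x ∈ Set.range (algebraMap k K)) (u : P.ringAˣ) :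
    P.abs (u : P.ringA) ≤ 1 := by
  by_cases hx : IsAlgebraic k ((u : P.ringA) : K)
  · exact (P.abs_eq_one_of_mem_range (hconst _ hx) (by simp)).le
  obtain ⟨O, hO⟩ := exists_valuationSubring_mem_nonunits (k := k) hx
  rw [P.abs_le_one_iff]
  -- a transcendental unit of `A` has a zero, which can only be the place itself
  suffices h : O = P.valuation.valuationSubring by
    rw [← h]; exact O.nonunits_subset hO
  by_contra h
  have h1 := P.mem_ringA.1 (u⁻¹ : P.ringAˣ).val.2 O h
  have h2 : ((u : P.ringA) : K) * ((u⁻¹ : P.ringAˣ) : P.ringA) = 1 := by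
    exact_mod_cast congrArg Subtype.val u.mul_inv
  have h3 : ((u⁻¹ : P.ringAˣ) : P.ringA) = ((u : P.ringA) : K)⁻¹ := eq_inv_of_mul_eq_one_right h2
  rw [h3] at h1
  have := O.inv_mem_nonunits_iff (x := ((u : P.ringA) : K)⁻¹)
  rw [inv_inv] at this
  rcases this.1 hO with h4 | h4
  · simp at h4
  · exact h4 h1

theorem abs_unit [Fintype k]
    (hconst : ∀ x : K, IsAlgebraic k x → x ∈ Set.range (algebraMap k K)) (u : P.ringAˣ) :
    P.abs (u : P.ringA) = 1 := by
  have h1 := P.abs_le_one_of_unit hconst u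
  have h2 := P.abs_le_one_of_unit hconst u⁻¹
  have h3 : P.abs (u : P.ringA) * P.abs (u⁻¹ : P.ringAˣ).val = 1 := by
    rw [← map_mul, ← map_one P.abs]
    congr 1
    exact_mod_cast congrArg Subtype.val u.mul_inv
  refine le_antisymm h1 ?_
  rw [← h3]
  exact mul_le_of_le_one_right (P.abs.nonneg _) h2

end Place

end Constants

/-! ### Residue extensions and quadratic polynomials over a complete field -/

section Norms

variable {F C : Type*} [NontriviallyNormedField F] [NormedField C] [NormedAlgebra F C]

theorem mem_range_of_mem_closure [CompleteSpace F] {x : C}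
    (h : x ∈ closure (Set.range (algebraMap F C))) : x ∈ Set.range (algebraMap F C) := by
  have h1 : Isometry (algebraMap F C) := algebraMap_isometry F C
  rwa [h1.isClosedEmbedding.isClosed_range.closure_eq] at h

variable {k : Type*} [Field k] [Fintype k] (h : k →+* C)

theorem norm_eq_one_of_pow_eq_self {m : ℕ} (hm : 1 < m) {z : C} (hz : z ^ m = z) (h0 : z ≠ 0) :
    ‖z‖ = 1 := by
  have : z ^ (m - 1) = 1 := by
    have h1 : z ^ (m - 1) * z = 1 * z := by
      rw [← pow_succ, Nat.sub_add_cancel hm.le, hz, one_mul]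
    exact mul_right_cancel₀ h0 h1
  have h2 := congrArg norm this
  rw [norm_pow, norm_one] at h2
  exact (pow_eq_one_iff_of_nonneg (norm_nonneg _) (by omega)).1 h2

include h in
/-- An element of a finite field in `C` that is congruent to an element of `F` lies in `F`:
it is the limit of the iterated Frobenius powers of that element. -/
theorem mem_range_of_norm_add_lt_one [CompleteSpace F] {z : F} {ε : C}
    (hε : (ε ^ Fintype.card k) ^ Fintype.card k = ε) (hlt : ‖algebraMap F C z + ε‖ < 1) :
    ε ∈ Set.range (algebraMap F C) := by
  obtain ⟨φ, hφ⟩ := exists_frobenius h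
  have hit : ∀ n x, (φ^[2 * n]) x = x ^ (Fintype.card k ^ (2 * n)) := by
    intro n x
    have : (φ : C → C) = fun x => x ^ Fintype.card k := funext hφ
    rw [this, pow_iterate]
  have hε' : ∀ n, (φ^[2 * n]) ε = ε := by
    intro n
    rw [Function.iterate_mul]
    refine Function.iterate_fixed ?_ n
    simp [hφ, hε]
  have hlim : Filter.Tendsto (fun n => algebraMap F C (-(z ^ (Fintype.card k ^ (2 * n)))))
      Filter.atTop (nhds ε) := by
    have h1 : Filter.Tendsto (fun n : ℕ => (algebraMap F C z + ε) ^ (Fintype.card k ^ (2 * n)))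
        Filter.atTop (nhds 0) := by
      refine (tendsto_pow_atTop_nhds_zero_of_norm_lt_one hlt).comp ?_
      refine (tendsto_pow_atTop_atTop_of_one_lt (Fintype.one_lt_card (α := k))).comp ?_
      exact Filter.tendsto_id.const_mul_atTop' two_pos
    have h2 : (fun n => algebraMap F C (-(z ^ (Fintype.card k ^ (2 * n))))) =
        fun n : ℕ => ε - (algebraMap F C z + ε) ^ (Fintype.card k ^ (2 * n)) := by
      funext n
      rw [← hit, iterate_map_add, hε', hit, map_neg, map_pow]
      ring
    rw [h2]
    simpa using h1.const_sub ε
  exact mem_range_of_mem_closure (mem_closure_of_tendsto hlim (Filter.Eventually.of_forall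
    fun n => ⟨_, rfl⟩))

include h in
theorem norm_add_mul_eq_max [CompleteSpace F] [IsUltrametricDist C] {ε : C}
    (hε : (ε ^ Fintype.card k) ^ Fintype.card k = ε) (hε' : ε ∉ Set.range (algebraMap F C))
    (x y : F) : ‖algebraMap F C x + ε * algebraMap F C y‖ = max ‖x‖ ‖y‖ := by
  have h0 : ε ≠ 0 := by rintro rfl; exact hε' ⟨0, map_zero _⟩
  have h1 : ‖ε‖ = 1 := by
    rw [← pow_mul] at hε
    have := Fintype.one_lt_card (α := k)
    exact norm_eq_one_of_pow_eq_self (by nlinarith) hε h0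
  by_cases hxy : ‖x‖ = ‖y‖
  · by_cases hy : y = 0
    · subst hy
      rw [norm_zero, norm_eq_zero] at hxy
      simp [hxy]
    refine le_antisymm ?_ ?_
    · refine (IsUltrametricDist.norm_add_le_max _ _).trans ?_
      rw [norm_mul, h1, one_mul, norm_algebraMap', norm_algebraMap']
    · rw [hxy, max_self]
      by_contra hlt
      push Not at hlt
      refine hε' (mem_range_of_norm_add_lt_one h (z := x / y) hε ?_)
      have hy' : algebraMap F C y ≠ 0 := by simpa using hy
      have : algebraMap F C (x / y) + ε =
          (algebraMap F C x + ε * algebraMap F C y) / algebraMap F C y := by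
        rw [map_div₀]; field_simp
      rw [this, norm_div, norm_algebraMap', div_lt_one (norm_pos_iff.2 hy)]
      exact hlt
  · rw [IsUltrametricDist.norm_add_eq_max_of_norm_ne_norm]
    · rw [norm_mul, h1, one_mul, norm_algebraMap', norm_algebraMap']
    · rw [norm_mul, h1, one_mul, norm_algebraMap', norm_algebraMap']
      exact hxy

/-- If the product of the roots of a quadratic polynomial over `F` is a unit and their sum is not
integral, then the roots lie in `F`: the larger one is the limit of the quotients of
consecutive power sums. -/
theorem mem_range_of_one_lt_norm_trace [CompleteSpace F] [IsUltrametricDist C] {t n : F} {x : C}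
    (hx : x ^ 2 - algebraMap F C t * x + algebraMap F C n = 0) (ht : 1 < ‖t‖) (hn : ‖n‖ = 1) :
    x ∈ Set.range (algebraMap F C) := by
  -- it suffices to treat the root of larger absolute value
  have key : ∀ x y : C, x + y = algebraMap F C t → x * y = algebraMap F C n → ‖y‖ < ‖x‖ →
      x ∈ Set.range (algebraMap F C) := by
    intro x y hs hp hlt
    have hx0 : x ≠ 0 := norm_pos_iff.1 ((norm_nonneg y).trans_lt hlt)
    have hpow : ∀ m : ℕ, x ^ m + y ^ m ∈ Set.range (algebraMap F C) ∧
        x ^ (m + 1) + y ^ (m + 1) ∈ Set.range (algebraMap F C) := by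
      intro m
      induction m with
      | zero => exact ⟨⟨2, by simp [map_ofNat]; norm_num⟩, ⟨t, by simp [hs]⟩⟩
      | succ m ih =>
        refine ⟨ih.2, ?_⟩
        obtain ⟨⟨a, ha⟩, ⟨b, hb⟩⟩ := ih
        refine ⟨t * b - n * a, ?_⟩
        rw [map_sub, map_mul, map_mul, ha, hb, ← hs, ← hp]
        ring
    have hu : ‖y / x‖ < 1 := by
      rw [norm_div, div_lt_one (norm_pos_iff.2 hx0)]; exact hlt
    have hlim : Filter.Tendsto (fun m : ℕ => (x ^ (m + 1) + y ^ (m + 1)) / (x ^ m + y ^ m))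
        Filter.atTop (nhds x) := by
      have h1 := tendsto_pow_atTop_nhds_zero_of_norm_lt_one hu
      have h2 : Filter.Tendsto (fun m : ℕ => (x + y * (y / x) ^ m) / (1 + (y / x) ^ m))
          Filter.atTop (nhds ((x + y * 0) / (1 + 0))) :=
        ((h1.const_mul y).const_add x).div (h1.const_add 1) (by simp)
      simp only [mul_zero, add_zero, div_one] at h2
      refine h2.congr fun m => ?_
      have hm : x ^ m ≠ 0 := pow_ne_zero _ hx0
      rw [← mul_div_mul_left _ _ hm, div_pow]
      congr 1
      · field_simp; ring
      · field_simp
    refine mem_range_of_mem_closure (mem_closure_of_tendsto hlim (Filter.Eventually.of_forall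
      fun m => ?_))
    obtain ⟨⟨a, ha⟩, ⟨b, hb⟩⟩ := hpow m
    exact ⟨b / a, by rw [map_div₀, ha, hb]⟩
  set y := algebraMap F C t - x with hy
  have hs : x + y = algebraMap F C t := by rw [hy]; ring
  have hp : x * y = algebraMap F C n := by rw [hy]; linear_combination -hx
  rcases lt_trichotomy ‖y‖ ‖x‖ with hlt | heq | hlt
  · exact key x y hs hp hlt
  · exfalso
    have h1 : ‖x‖ * ‖y‖ = 1 := by rw [← norm_mul, hp, norm_algebraMap', hn]
    have h2 : ‖x‖ = 1 := by
      rw [heq] at h1; nlinarith [norm_nonneg x]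
    have h3 := IsUltrametricDist.norm_add_le_max x y
    rw [hs, norm_algebraMap', heq, h2, max_self] at h3
    exact absurd ht (not_lt.2 h3)
  · obtain ⟨a, ha⟩ := key y x (by rw [add_comm, hs]) (by rw [mul_comm, hp]) hlt
    exact ⟨t - a, by rw [map_sub, ha, ← hs]; ring⟩

end Norms

/-! ### Lattice norms and vertices -/

section Lattices

variable {F : Type*} [NontriviallyNormedField F] [IsUltrametricDist F]

/-- For a discrete absolute value, the infimum in the definition of the norm of a lattice is
attained. -/
theorem OLattice.norm_mem_scales (hF : ∀ x y : F, ‖x‖ < ‖y‖ → 2 * ‖x‖ ≤ ‖y‖) (L : OLattice F)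
    (x : Fin 2 → F) : L.norm.toFun x ∈ L.scales x := by
  change sInf (L.scales x) ∈ L.scales x
  have h0 : 0 ≤ sInf (L.scales x) :=
    le_csInf (L.scales_nonempty x) (by rintro r ⟨c, rfl, -⟩; exact norm_nonneg c)
  rcases h0.eq_or_lt with h | h
  · rw [← h]
    obtain rfl : x = 0 := L.norm.eq_zero x h.symm
    exact ⟨0, norm_zero, 0, zero_mem _, by simp⟩
  · obtain ⟨r, hr, h1⟩ := exists_lt_of_csInf_lt (L.scales_nonempty x)
      (show sInf (L.scales x) < 2 * sInf (L.scales x) by linarith)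
    rcases (csInf_le (L.scales_bddBelow x) hr).eq_or_lt with h2 | h2
    · rwa [h2]
    · obtain ⟨s, hs, h3⟩ := exists_lt_of_csInf_lt (L.scales_nonempty x) h2
      have h4 := csInf_le (L.scales_bddBelow x) hs
      obtain ⟨c, rfl, -⟩ := hr
      obtain ⟨d, rfl, -⟩ := hs
      linarith [hF d c h3]

theorem OLattice.mem_carrier_iff (hF : ∀ x y : F, ‖x‖ < ‖y‖ → 2 * ‖x‖ ≤ ‖y‖) (L : OLattice F)
    {x : Fin 2 → F} : x ∈ L.carrier ↔ L.norm.toFun x ≤ 1 := by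
  constructor
  · intro h
    exact csInf_le (L.scales_bddBelow x) ⟨1, norm_one, x, h, (one_smul _ _).symm⟩
  · intro h
    obtain ⟨c, hc, y, hy, rfl⟩ := L.norm_mem_scales hF x
    obtain ⟨z, hz, e⟩ := L.mem_of_norm_le (c := c) (d := 1) (by rw [hc, norm_one]; exact h) hy
    rw [e, one_smul]
    exact hz

theorem Vertex.toPoint_injective (hF : ∀ x y : F, ‖x‖ < ‖y‖ → 2 * ‖x‖ ≤ ‖y‖) :
    Function.Injective (Vertex.toPoint (F := F)) := by
  intro v v'
  refine Quotient.inductionOn₂ v v' fun L L' h => ?_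
  obtain ⟨r, hr, h⟩ := Quotient.exact h
  apply Quotient.sound
  -- the ratio of the two norms is a value of the absolute value of `F`
  obtain ⟨c, hc⟩ : ∃ c : F, ‖c‖ = r := by
    obtain ⟨c, hc, -⟩ := L.norm_mem_scales hF 1
    obtain ⟨d, hd, -⟩ := L'.norm_mem_scales hF 1
    refine ⟨d / c, ?_⟩
    have h1 : L.norm.toFun 1 ≠ 0 := fun h0 => one_ne_zero (L.norm.eq_zero 1 h0)
    rw [norm_div, hc, hd, h, mul_div_cancel_right₀ _ h1]
  have hc0 : c ≠ 0 := norm_pos_iff.1 (hc ▸ hr)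
  refine ⟨c⁻¹, inv_ne_zero hc0, fun x => ?_⟩
  rw [OLattice.mem_carrier_iff hF, OLattice.mem_carrier_iff hF, h, L.norm.map_smul, norm_inv, hc,
    mul_inv_cancel_left₀ hr.ne']

theorem OLattice.norm_smul (g : GL (Fin 2) F) (L : OLattice F) (x : Fin 2 → F) :
    (g • L).norm.toFun x = L.norm.toFun (Matrix.vecMul x g.val) := by
  change sInf _ = sInf _
  congr 1
  ext r
  constructor
  · rintro ⟨c, rfl, y, hy, rfl⟩
    exact ⟨c, rfl, _, OLattice.mem_smul.1 hy, Matrix.smul_vecMul _ _ _⟩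
  · rintro ⟨c, rfl, y, hy, e⟩
    have hy' : Matrix.vecMul (Matrix.vecMul y (g⁻¹).val) g.val = y := by
      rw [Matrix.vecMul_vecMul, ← Units.val_mul, inv_mul_cancel]; simp
    refine ⟨c, rfl, Matrix.vecMul y (g⁻¹).val, ?_, ?_⟩
    · rw [OLattice.mem_smul, hy']; exact hy
    · rw [← Matrix.smul_vecMul, ← e, Matrix.vecMul_vecMul, ← Units.val_mul, mul_inv_cancel]
      simp

variable {C : Type*} [NormedField C] [NormedAlgebra F C] [IsUltrametricDist C]

/-- If the norm of `ω` is the maximum norm for some basis, it is the norm of a lattice. -/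
theorem HalfPlane.exists_vertex (ω : HalfPlane F C) {a b : F} (hb : b ≠ 0)
    (hmax : ∀ x, ω.norm.toFun x = max ‖x 0 * a + x 1‖ ‖x 0 * b‖) :
    ∃ v : Vertex F, buildingMap ω = v.toPoint := by
  set M : Submodule (Integers F) (Fin 2 → F) :=
    Submodule.span (Integers F) {![0, 1], ![b⁻¹, -(a * b⁻¹)]} with hM
  have hint : ∀ c : F, ‖c‖ ≤ 1 ↔ c ∈ Integers F := by
    intro c
    rw [Valuation.mem_integer_iff, NormedField.valuation_apply, ← NNReal.coe_le_coe, coe_nnnorm,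
      NNReal.coe_one]
  have hdec : ∀ x : Fin 2 → F,
      x = (x 0 * a + x 1) • ![0, 1] + (x 0 * b) • ![b⁻¹, -(a * b⁻¹)] := by
    intro x
    ext i
    fin_cases i
    · simp [hb]
    · simp; field_simp; ring
  have hmem : ∀ x, ω.norm.toFun x ≤ 1 ↔ x ∈ M := by
    intro x
    rw [hM, Submodule.mem_span_pair, hmax, max_le_iff]
    constructor
    · rintro ⟨h1, h2⟩
      exact ⟨⟨_, (hint _).1 h1⟩, ⟨_, (hint _).1 h2⟩, (hdec x).symm⟩
    · rintro ⟨s, t, rfl⟩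
      have hs := (hint _).2 s.2
      have ht := (hint _).2 t.2
      constructor
      · simp only [Subring.smul_def]; simpa [mul_assoc, mul_comm, mul_left_comm] using hs
      · simp only [Subring.smul_def]; simpa [hb] using ht
  have hspan : Submodule.span F (M : Set (Fin 2 → F)) = ⊤ := by
    refine Submodule.eq_top_iff'.2 fun x => ?_
    rw [hdec x]
    refine add_mem (Submodule.smul_mem _ _ (Submodule.subset_span ?_))
      (Submodule.smul_mem _ _ (Submodule.subset_span ?_))
    · exact Submodule.subset_span (by simp)
    · exact Submodule.subset_span (by simp)
  let L : OLattice F := ⟨M, ⟨Submodule.fg_span (Set.toFinite _), hspan⟩⟩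
  refine ⟨Vertex.mk L, Quotient.sound ⟨1, one_pos, fun x => ?_⟩⟩
  rw [one_mul]
  change sInf (L.scales x) = _
  refine le_antisymm (csInf_le (L.scales_bddBelow x) ?_) (le_csInf (L.scales_nonempty x) ?_)
  · obtain ⟨c, hc⟩ : ∃ c : F, ‖c‖ = ω.norm.toFun x := by
      rw [hmax]
      rcases max_choice ‖x 0 * a + x 1‖ ‖x 0 * b‖ with h | h <;> rw [h] <;> exact ⟨_, rfl⟩
    by_cases h0 : c = 0
    · obtain rfl : x = 0 := ω.norm.eq_zero x (by rw [← hc, h0, norm_zero])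
      exact ⟨c, hc, 0, zero_mem _, by simp⟩
    · refine ⟨c, hc, c⁻¹ • x, (hmem _).1 ?_, by rw [smul_inv_smul₀ h0]⟩
      rw [ω.norm.map_smul, norm_inv, ← hc, inv_mul_cancel₀ (norm_ne_zero_iff.2 h0)]
  · rintro r ⟨c, rfl, y, hy, rfl⟩
    rw [ω.norm.map_smul]
    exact mul_le_of_le_one_right (norm_nonneg _) ((hmem y).2 hy)

/-- The stabilizer of the vertex of `ω` consists of the similitudes of the norm of `ω`. -/
theorem HalfPlane.smul_vertex_eq_iff (hF : ∀ x y : F, ‖x‖ < ‖y‖ → 2 * ‖x‖ ≤ ‖y‖)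
    {ω : HalfPlane F C} {v : Vertex F} (hv : buildingMap ω = v.toPoint) (g : GL (Fin 2) F) :
    g • v = v ↔ ∃ r : ℝ, 0 < r ∧
      ∀ x, ω.norm.toFun (Matrix.vecMul x g.val) = r * ω.norm.toFun x := by
  rw [← (Vertex.toPoint_injective hF).eq_iff]
  obtain ⟨L, rfl⟩ : ∃ L, Vertex.mk L = v := Quotient.exists_rep v
  obtain ⟨s, hs, h⟩ := Quotient.exact hv
  change ∀ x, L.norm.toFun x = s * ω.norm.toFun x at h
  change TreePoint.mk (g • L).norm = TreePoint.mk L.norm ↔ _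
  have hs' := hs.ne'
  constructor
  · intro h'
    obtain ⟨r, hr, h'⟩ := Quotient.exact h'.symm
    change ∀ x, (g • L).norm.toFun x = r * L.norm.toFun x at h'
    refine ⟨r, hr, fun x => ?_⟩
    have := h' x
    rw [OLattice.norm_smul, h, h] at this
    apply mul_left_cancel₀ hs'
    rw [this]; ring
  · rintro ⟨r, hr, h'⟩
    refine (Quotient.sound ⟨r, hr, fun x => ?_⟩ :
      TreePoint.mk L.norm = TreePoint.mk (g • L).norm).symm
    rw [OLattice.norm_smul, h, h, h']; ring

end Lattices

/-! ### Cyclic algebras over a finite field -/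

section CyclicAlgebra

/-- Splitting of `M` into a part that commutes with `l` and a part that interchanges `l` and its
conjugate `l'`, if the trace and the norm of `l` commute with `M`. -/
theorem conj_decomposition {R : Type*} [Ring R] {l l' d M : R} (hll : l * l' = l' * l)
    (hd : d * (l - l') = 1) (hdl : l * d = d * l) (hdl' : l' * d = d * l')
    (ht : (l + l') * M = M * (l + l')) (hn : l * l' * M = M * (l * l')) :
    l * (d * (M * l - l' * M)) = d * (M * l - l' * M) * l ∧
    (M - d * (M * l - l' * M)) * l = l' * (M - d * (M * l - l' * M)) := by
  set X := M * l - l' * M with hX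
  have h1 : l * X = X * l := by
    have h2 : (l + l') * M * l - l * l' * M = M * (l + l') * l - M * (l * l') := by rw [ht, hn]
    rw [hll] at h2
    have h3 : l * X - X * l = ((l + l') * M * l - l * l' * M) - M * l * l := by
      rw [hX]; noncomm_ring
    have h4 : M * (l + l') * l - M * (l' * l) = M * l * l := by noncomm_ring
    rw [← sub_eq_zero, h3, hll, h2, h4, sub_self]
  have h2 : l * (d * X) = d * X * l := by
    rw [← mul_assoc, hdl, mul_assoc, h1, mul_assoc]
  refine ⟨h2, ?_⟩
  have h3 : d * X * l - l' * (d * X) = X := by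
    rw [← h2, ← mul_assoc, ← mul_assoc, hdl, hdl', ← sub_mul, ← mul_sub, hd, one_mul]
  rw [sub_mul, mul_sub l', sub_eq_sub_iff_sub_eq_sub, h3]

variable {k k₂ : Type*} [Field k] [Fintype k] [Field k₂] [Fintype k₂]

/-- Surjectivity of the norm for a quadratic extension of finite fields. -/
theorem exists_norm_eq (hcard : Fintype.card k₂ = Fintype.card k ^ 2) {n : k₂}
    (hn : n ^ Fintype.card k = n) (h0 : n ≠ 0) : ∃ c : k₂, c * c ^ Fintype.card k = n := by
  classical
  obtain ⟨g, hg⟩ := IsCyclic.exists_generator (α := k₂ˣ)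
  obtain ⟨m, hm⟩ := (Submonoid.mem_powers_iff _ _).1
    ((mem_powers_iff_mem_zpowers).2 (hg (Units.mk0 n h0)))
  have hq := Fintype.one_lt_card (α := k)
  set q := Fintype.card k
  have hord : orderOf g = (q - 1) * (q + 1) := by
    rw [orderOf_eq_card_of_forall_mem_zpowers hg, Nat.card_eq_fintype_card, Fintype.card_units,
      hcard]
    simpa [mul_comm] using Nat.sq_sub_sq q 1
  have h1 : g ^ (m * (q - 1)) = 1 := by
    rw [pow_mul, hm]
    apply Units.ext
    rw [Units.val_pow_eq_pow_val, Units.val_mk0, Units.val_one]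
    apply mul_right_cancel₀ h0
    rw [← pow_succ, Nat.sub_add_cancel hq.le, hn, one_mul]
  have h2 : q + 1 ∣ m := by
    rw [← orderOf_dvd_iff_pow_eq_one, hord, mul_comm m] at h1
    exact Nat.dvd_of_mul_dvd_mul_left (by omega) h1
  obtain ⟨s, rfl⟩ := h2
  refine ⟨((g ^ s : k₂ˣ) : k₂), ?_⟩
  have := congrArg Units.val hm
  rw [Units.val_mk0] at this
  rw [← this, ← Units.val_pow_eq_pow_val, ← Units.val_mul, ← pow_mul, ← pow_add]
  congr 2; ring

/-- Every `k`-linear endomorphism of `k₂` is of the form `y ↦ z y + w y ^ q`. -/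
theorem exists_endomorphism_eq [Algebra k k₂] (hcard : Fintype.card k₂ = Fintype.card k ^ 2) :
    ∃ θ : k₂ × k₂ ≃ Module.End k k₂,
      ∀ p y, θ p y = p.1 * y + p.2 * y ^ Fintype.card k := by
  have hrank : Module.finrank k k₂ = 2 := by
    have h := Module.card_eq_pow_finrank (K := k) (V := k₂)
    rw [hcard] at h
    exact (Nat.pow_right_injective Fintype.one_lt_card h).symm
  let φ : k₂ →ₐ[k] k₂ := FiniteField.frobeniusAlgHom k k₂
  have hφ : ∀ y, φ y = y ^ Fintype.card k := fun y => rfl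
  let θ : k₂ × k₂ → Module.End k k₂ := fun p =>
    LinearMap.mulLeft k p.1 + LinearMap.mulLeft k p.2 ∘ₗ φ.toLinearMap
  have hθ : ∀ p y, θ p y = p.1 * y + p.2 * y ^ Fintype.card k := fun p y => rfl
  have hinj : Function.Injective θ := by
    rintro ⟨z, w⟩ ⟨z', w'⟩ h
    have h1 : ∀ y, (z - z') * y + (w - w') * y ^ Fintype.card k = 0 := by
      intro y
      have := LinearMap.congr_fun h y
      rw [hθ, hθ] at this
      simp only at this
      linear_combination this
    -- some element of `k₂` is not fixed by the Frobenius automorphism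
    obtain ⟨y, hy⟩ : ∃ y : k₂, y ^ Fintype.card k ≠ y := by
      by_contra hall
      push Not at hall
      have hsurj : Function.Surjective (algebraMap k k₂) := fun y =>
        (pow_card_eq_self_iff (algebraMap k k₂)).1 (hall y)
      have := Fintype.card_le_of_surjective _ hsurj
      rw [hcard] at this
      nlinarith [Fintype.one_lt_card (α := k)]
    have h2 := h1 1
    have h3 := h1 y
    rw [one_pow, mul_one, mul_one] at h2
    have h4 : (w - w') * (y ^ Fintype.card k - y) = 0 := by linear_combination h3 - y * h2
    have h5 : w - w' = 0 := (mul_eq_zero.1 h4).resolve_right (sub_ne_zero.2 hy)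
    rw [h5, add_zero] at h2
    rw [sub_eq_zero.1 h2, sub_eq_zero.1 h5]
  have : Finite (Module.End k k₂) := Module.finite_of_finite k
  have hbij : Function.Bijective θ := by
    refine hinj.bijective_of_nat_card_le ?_
    rw [Nat.card_prod, Module.natCard_eq_pow_finrank (K := k), Module.finrank_linearMap, hrank,
      Nat.card_eq_fintype_card, Nat.card_eq_fintype_card, hcard]
    exact le_of_eq (by ring)
  exact ⟨Equiv.ofBijective θ hbij, hθ⟩

/-- If `k₂` and an involution `τ` inducing the Frobenius automorphism of `k₂` generate a
subring `k₂ ⊕ k₂ τ` of `R`, then this subring is the ring of endomorphisms of the `k`-vector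
space `k₂`, and its group of units is `GL₂(k)`. -/
theorem units_mulEquiv_GL {R : Type*} [Ring R] [Algebra k k₂]
    (hcard : Fintype.card k₂ = Fintype.card k ^ 2) (j : k₂ →+* R) {τ : R} (hτ : τ * τ = 1)
    (hτj : ∀ z, τ * j z = j (z ^ Fintype.card k) * τ)
    (hj : ∀ z w, j z + j w * τ = 0 → z = 0 ∧ w = 0) (H : Subgroup Rˣ)
    (hH : ∀ u : Rˣ, u ∈ H ↔ (∃ z w, u.val = j z + j w * τ) ∧ ∃ z w, u⁻¹.val = j z + j w * τ) :
    Nonempty (H ≃* GL (Fin 2) k) := by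
  obtain ⟨θ, hθ⟩ := exists_endomorphism_eq hcard
  let ρ : k₂ × k₂ → R := fun p => j p.1 + j p.2 * τ
  have hρ : Function.Injective ρ := by
    rintro ⟨z, w⟩ ⟨z', w'⟩ h
    have h' : j z + j w * τ = j z' + j w' * τ := h
    obtain ⟨h1, h2⟩ := hj (z - z') (w - w') (by
      rw [map_sub, map_sub, sub_mul, sub_add_sub_comm, h', sub_self])
    rw [sub_eq_zero.1 h1, sub_eq_zero.1 h2]
  let m : k₂ × k₂ → k₂ × k₂ → k₂ × k₂ := fun p p' =>
    (p.1 * p'.1 + p.2 * p'.2 ^ Fintype.card k, p.1 * p'.2 + p.2 * p'.1 ^ Fintype.card k)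
  have hφ : ∀ x y : k₂, (x + y) ^ Fintype.card k = x ^ Fintype.card k + y ^ Fintype.card k :=
    fun x y => map_add (FiniteField.frobeniusAlgHom k k₂) x y
  have hφ2 : ∀ x : k₂, (x ^ Fintype.card k) ^ Fintype.card k = x := fun x => by
    rw [← pow_mul, ← pow_two, ← hcard, FiniteField.pow_card]
  have hθm : ∀ p p', θ p * θ p' = θ (m p p') := by
    intro p p'
    ext y
    rw [Module.End.mul_apply, hθ, hθ, hθ, hφ, mul_pow, mul_pow, hφ2]
    ring
  have hρm : ∀ p p', ρ p * ρ p' = ρ (m p p') := by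
    rintro ⟨z, w⟩ ⟨z', w'⟩
    change (j z + j w * τ) * (j z' + j w' * τ) = j (_ + _) + j (_ + _) * τ
    have h1 : j w * τ * j z' = j w * j (z' ^ Fintype.card k) * τ := by
      rw [mul_assoc, hτj, mul_assoc]
    have h2 : j w * τ * (j w' * τ) = j w * j (w' ^ Fintype.card k) := by
      rw [mul_assoc, ← mul_assoc τ, hτj, mul_assoc (j _) τ τ, hτ, mul_one]
    rw [add_mul, mul_add, mul_add, h1, h2]
    simp only [map_add, map_mul]
    noncomm_ring
  let Φ : Module.End k k₂ →* R :=
    { toFun := fun u => ρ (θ.symm u)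
      map_one' := by
        have : θ (1, 0) = 1 := by ext y; rw [hθ]; simp
        rw [← this, Equiv.symm_apply_apply]
        simp [ρ]
      map_mul' := fun u v => by
        rw [hρm]
        congr 1
        rw [Equiv.symm_apply_eq, ← hθm, Equiv.apply_symm_apply, Equiv.apply_symm_apply] }
  have hΦ : Function.Injective Φ := fun u v h => θ.symm.injective (hρ h)
  have hΦρ : ∀ p, Φ (θ p) = ρ p := fun p => by
    change ρ (θ.symm (θ p)) = _
    rw [Equiv.symm_apply_apply]
  let U : (Module.End k k₂)ˣ →* Rˣ := Units.map Φ
  have hU : Function.Injective U := Units.map_injective hΦ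
  have hrange : U.range = H := by
    ext u
    rw [hH]
    constructor
    · rintro ⟨x, rfl⟩
      exact ⟨⟨_, _, rfl⟩, ⟨(θ.symm x⁻¹.val).1, (θ.symm x⁻¹.val).2, by
        rw [← map_inv]; rfl⟩⟩
    · rintro ⟨⟨z, w, h⟩, ⟨z', w', h'⟩⟩
      have h1 : Φ (θ (z, w)) = u.val := by rw [hΦρ]; exact h.symm
      have h2 : Φ (θ (z', w')) = u⁻¹.val := by rw [hΦρ]; exact h'.symm
      refine ⟨⟨θ (z, w), θ (z', w'), ?_, ?_⟩, Units.ext h1⟩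
      · apply hΦ; rw [map_mul, h1, h2, Units.mul_inv, map_one]
      · apply hΦ; rw [map_mul, h1, h2, Units.inv_mul, map_one]
  have hrank : Module.finrank k k₂ = 2 := by
    have h := Module.card_eq_pow_finrank (K := k) (V := k₂)
    rw [hcard] at h
    exact (Nat.pow_right_injective Fintype.one_lt_card h).symm
  let e1 : (Module.End k k₂)ˣ ≃* GL (Fin 2) k :=
    Units.mapEquiv (algEquivMatrix (Module.finBasisOfFinrankEq k k₂ hrank)).toMulEquiv
  exact ⟨(MulEquiv.subgroupCongr hrange).symm.trans ((MonoidHom.ofInjective hU).symm.trans e1)⟩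

end CyclicAlgebra

/-! ### The quadratic extension of the constant field -/

/-- A field with `q²` elements embeds into an extension of a field with `q` elements that contains
a solution `ε` of `ε ^ q ^ 2 = ε`, `ε ^ q ≠ ε`. -/
theorem exists_quadratic_embedding {k k₂ C : Type*} [Field k] [Fintype k] [Field k₂] [Fintype k₂]
    [Field C] (h : k →+* C) {ε : C} (hε : (ε ^ Fintype.card k) ^ Fintype.card k = ε)
    (hε' : ε ^ Fintype.card k ≠ ε) (hcard : Fintype.card k₂ = Fintype.card k ^ 2) :
    ∃ i : k₂ →+* C, (∀ z, ∃ p : k × k, i z = h p.1 + ε * h p.2) ∧ ∃ l, i l = ε := by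
  classical
  obtain ⟨φ, hφ⟩ := exists_frobenius h
  have hhφ : ∀ x, φ (h x) = h x := fun x => by rw [hφ, ← map_pow, FiniteField.pow_card]
  -- the solutions of `x ^ q ^ 2 = x` form a field with `q ^ 2` elements
  let S : Subfield C := (φ.comp φ).eqLocusField (RingHom.id C)
  have hS : ∀ x, x ∈ S ↔ x ^ Fintype.card k ^ 2 = x := by
    intro x
    change φ (φ x) = x ↔ _
    rw [hφ, hφ, ← pow_mul, ← pow_two]
  have hmem : ∀ p : k × k, h p.1 + ε * h p.2 ∈ S := by
    intro p
    change φ (φ _) = _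
    have : φ (φ ε) = ε := by rw [hφ, hφ, hε]
    simp only [map_add, map_mul, hhφ, this, RingHom.id_apply]
  let Ψ : k × k → S := fun p => ⟨_, hmem p⟩
  have hΨ : Function.Injective Ψ := by
    rintro ⟨x, y⟩ ⟨x', y'⟩ h0
    have h1 : h x + ε * h y = h x' + ε * h y' := congrArg Subtype.val h0
    have hy : y = y' := by
      by_contra hy
      have hy' : h (y - y') ≠ 0 := (map_ne_zero h).2 (sub_ne_zero.2 hy)
      refine hε' ((pow_card_eq_self_iff h).2 ⟨(x' - x) / (y - y'), ?_⟩)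
      rw [map_div₀, div_eq_iff hy', map_sub, map_sub]
      linear_combination -h1
    subst hy
    rw [h.injective (add_right_cancel h1)]
  have hq := Fintype.one_lt_card (α := k)
  have hq2 : 1 < Fintype.card k ^ 2 := by nlinarith
  let p : Polynomial C := Polynomial.X ^ Fintype.card k ^ 2 - Polynomial.X
  have hp : p ≠ 0 := FiniteField.X_pow_card_sub_X_ne_zero C hq2
  have hsub : ∀ x : S, (x : C) ∈ p.roots.toFinset := by
    intro x
    rw [Multiset.mem_toFinset, Polynomial.mem_roots hp]
    simp [p, (hS x).1 x.2]
  let T : S → p.roots.toFinset := fun x => ⟨x, hsub x⟩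
  have hT : Function.Injective T := fun x y hxy =>
    Subtype.ext (congrArg (fun t : p.roots.toFinset => (t : C)) hxy)
  have : Fintype S := Fintype.ofInjective T hT
  have hcardS : Fintype.card S ≤ Fintype.card k ^ 2 := by
    refine (Fintype.card_le_of_injective T hT).trans ?_
    rw [Fintype.card_coe]
    refine (Multiset.toFinset_card_le _).trans ((Polynomial.card_roots' _).trans ?_)
    exact (FiniteField.X_pow_card_sub_X_natDegree_eq C hq2).le
  have hcardS' : Fintype.card k ^ 2 ≤ Fintype.card S := by
    have := Fintype.card_le_of_injective Ψ hΨ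
    rwa [Fintype.card_prod, ← pow_two] at this
  have hcardE := le_antisymm hcardS hcardS'
  have hsurj : Function.Surjective Ψ := by
    refine ((Fintype.bijective_iff_injective_and_card Ψ).2 ⟨hΨ, ?_⟩).2
    rw [hcardE, Fintype.card_prod, pow_two]
  let E : k₂ ≃+* S := FiniteField.ringEquivOfCardEq (hcard.trans hcardE.symm)
  have hεS : ε ∈ S := by rw [hS, pow_two, pow_mul, hε]
  refine ⟨S.subtype.comp E.toRingHom, fun z => ?_, E.symm ⟨ε, hεS⟩, ?_⟩
  · obtain ⟨p, hp⟩ := hsurj (E z)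
    exact ⟨p, (congrArg Subtype.val hp).symm⟩
  · change ((E (E.symm ⟨ε, hεS⟩) : S) : C) = ε
    rw [RingEquiv.apply_symm_apply]

/-! ### Matrices as linear maps on the column `(ω, 1)` -/

section Columns

variable {F C A : Type*} [NontriviallyNormedField F] [NormedField C] [NormedAlgebra F C]
  [CommRing A] (f : A →+* F)

/-- The action of a matrix over `A` on columns over `C`. -/
def matC (C : Type*) [NormedField C] [NormedAlgebra F C] :
    Matrix (Fin 2) (Fin 2) A →+* Matrix (Fin 2) (Fin 2) C :=
  ((algebraMap F C).comp f).mapMatrix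

/-- The column `(ω, 1)`. -/
def HalfPlane.col (ω : HalfPlane F C) : Fin 2 → C := ![ω.val, 1]

@[simp] theorem HalfPlane.col_zero (ω : HalfPlane F C) : ω.col 0 = ω.val := rfl

@[simp] theorem HalfPlane.col_one (ω : HalfPlane F C) : ω.col 1 = 1 := rfl

variable {f}

theorem matC_mulVec_col {M : Matrix (Fin 2) (Fin 2) A} {ω : HalfPlane F C} {w : Fin 2 → C} :
    (matC f C M).mulVec ω.col = w ↔
      algebraMap F C (f (M 0 0)) * ω.val + algebraMap F C (f (M 0 1)) = w 0 ∧
      algebraMap F C (f (M 1 0)) * ω.val + algebraMap F C (f (M 1 1)) = w 1 := by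
  rw [funext_iff, Fin.forall_fin_two]
  simp [matC, HalfPlane.col, Matrix.mulVec, dotProduct, Fin.sum_univ_two]

theorem eq_zero_of_matC_mulVec_col (hf : Function.Injective f) {M : Matrix (Fin 2) (Fin 2) A}
    {ω : HalfPlane F C} (h : (matC f C M).mulVec ω.col = 0) : M = 0 := by
  obtain ⟨h0, h1⟩ := matC_mulVec_col.1 h
  obtain ⟨h00, h01⟩ := ω.eq_zero h0
  obtain ⟨h10, h11⟩ := ω.eq_zero h1
  ext i j
  fin_cases i <;> fin_cases j <;> apply hf <;> simpa

theorem eq_of_matC_mulVec_col (hf : Function.Injective f) {M N : Matrix (Fin 2) (Fin 2) A}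
    {ω : HalfPlane F C} (h : (matC f C M).mulVec ω.col = (matC f C N).mulVec ω.col) : M = N := by
  rw [← sub_eq_zero]
  refine eq_zero_of_matC_mulVec_col hf (ω := ω) ?_
  rw [map_sub, Matrix.sub_mulVec, h, sub_self]

theorem map_smul_eq_iff (g : GL (Fin 2) A) (ω ω' : HalfPlane F C) :
    Matrix.GeneralLinearGroup.map f g • ω' = ω ↔
      ∃ β : C, β ≠ 0 ∧ (matC f C g.val).mulVec ω'.col = β • ω.col := by
  constructor
  · rintro rfl
    have h := ω'.denom_ne_zero (Matrix.GeneralLinearGroup.map f g)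
    refine ⟨_, h, matC_mulVec_col.2 ?_⟩
    simp only [HalfPlane.col_zero, HalfPlane.col_one, HalfPlane.smul_val, Pi.smul_apply,
      smul_eq_mul, mul_one]
    rw [mul_div_cancel₀ _ h]
    exact ⟨rfl, rfl⟩
  · rintro ⟨β, hβ, h⟩
    obtain ⟨h0, h1⟩ := matC_mulVec_col.1 h
    simp only [Pi.smul_apply, smul_eq_mul, HalfPlane.col_zero, HalfPlane.col_one, mul_one] at h0 h1
    apply HalfPlane.ext
    rw [HalfPlane.smul_val]
    simp only [Matrix.GeneralLinearGroup.map_apply]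
    rw [h0, h1, mul_div_cancel_left₀ _ hβ]

theorem VecNorm.nonneg (N : VecNorm F) (x : Fin 2 → F) : 0 ≤ N.toFun x := by
  have h := N.map_add_le x (-x)
  have h0 : N.toFun 0 = 0 := by simpa using N.map_smul 0 0
  have h1 : N.toFun (-x) = N.toFun x := by simpa using N.map_smul (-1) x
  rwa [add_neg_cancel, h0, h1, max_self] at h

theorem VecNorm.pos (N : VecNorm F) {x : Fin 2 → F} (hx : x ≠ 0) : 0 < N.toFun x :=
  (N.nonneg x).lt_of_ne fun h => hx (N.eq_zero x h.symm)

theorem vecMul_map_inv (f : A →+* F) (g : GL (Fin 2) A) (x : Fin 2 → F) :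
    Matrix.vecMul (Matrix.vecMul x (g⁻¹.val.map f)) (g.val.map f) = x := by
  rw [Matrix.vecMul_vecMul, ← Matrix.map_mul, ← Units.val_mul, inv_mul_cancel]
  simp

theorem VecNorm.vecMul_inv (N : VecNorm F) {g : GL (Fin 2) A} {r : ℝ} (hr : 0 < r)
    (h : ∀ x, N.toFun (Matrix.vecMul x (g.val.map f)) = r * N.toFun x) (x : Fin 2 → F) :
    N.toFun (Matrix.vecMul x (g⁻¹.val.map f)) = r⁻¹ * N.toFun x := by
  rw [eq_inv_mul_iff_mul_eq₀ hr.ne', ← h, vecMul_map_inv]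

variable [IsUltrametricDist C]

theorem HalfPlane.norm_apply (ω : HalfPlane F C) (x : Fin 2 → F) :
    ω.norm.toFun x = ‖algebraMap F C (x 0) * ω.val + algebraMap F C (x 1)‖ := rfl

theorem norm_vecMul_of_mulVec_col {M : Matrix (Fin 2) (Fin 2) A} {ω ω' : HalfPlane F C} {β : C}
    (h : (matC f C M).mulVec ω'.col = β • ω.col) (x : Fin 2 → F) :
    ω'.norm.toFun (Matrix.vecMul x (M.map f)) = ‖β‖ * ω.norm.toFun x := by
  obtain ⟨h0, h1⟩ := matC_mulVec_col.1 h
  simp only [Pi.smul_apply, smul_eq_mul, HalfPlane.col_zero, HalfPlane.col_one, mul_one] at h0 h1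
  rw [HalfPlane.norm_apply, HalfPlane.norm_apply, ← norm_mul]
  congr 1
  simp only [Matrix.vecMul, dotProduct, Fin.sum_univ_two, Matrix.map_apply, map_add, map_mul]
  linear_combination algebraMap F C (x 0) * h0 + algebraMap F C (x 1) * h1

variable (f) in
/-- The matrices over `A` that do not increase a given norm on row vectors. For the norm of an
elliptic point these are the global endomorphisms of a vector bundle of rank two. -/
def contractions (N : VecNorm F) : Subring (Matrix (Fin 2) (Fin 2) A) where
  carrier := {M | ∀ x, N.toFun (Matrix.vecMul x (M.map f)) ≤ N.toFun x}
  mul_mem' := by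
    intro M M' h h' x
    rw [Matrix.map_mul, ← Matrix.vecMul_vecMul]
    exact (h' _).trans (h x)
  one_mem' := by intro x; simp
  add_mem' := by
    intro M M' h h' x
    rw [Matrix.map_add _ (map_add f), Matrix.vecMul_add]
    exact (N.map_add_le _ _).trans (max_le (h x) (h' x))
  zero_mem' := by
    intro x
    have h0 : N.toFun 0 = 0 := by simpa using N.map_smul 0 0
    rw [Matrix.map_zero _ (map_zero f), Matrix.vecMul_zero, h0]
    exact N.nonneg x
  neg_mem' := by
    intro M h x
    have h1 : (-M).map f = -M.map f := by ext; simp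
    have h2 : ∀ y, N.toFun (-y) = N.toFun y := fun y => by simpa using N.map_smul (-1) y
    rw [h1, Matrix.vecMul_neg, h2]
    exact h x

theorem mem_contractions_of_mulVec {M : Matrix (Fin 2) (Fin 2) A} {ω : HalfPlane F C} {μ : C}
    (h : (matC f C M).mulVec ω.col = μ • ω.col) (hμ : ‖μ‖ ≤ 1) :
    M ∈ contractions f ω.norm := by
  intro x
  rw [norm_vecMul_of_mulVec_col h]
  exact mul_le_of_le_one_left (ω.norm.nonneg _) hμ

theorem norm_le_one_of_mem_contractions {M : Matrix (Fin 2) (Fin 2) A} {ω : HalfPlane F C}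
    {μ : C}
    (hM : M ∈ contractions f ω.norm) (h : (matC f C M).mulVec ω.col = μ • ω.col) : ‖μ‖ ≤ 1 := by
  have := hM 1
  rw [norm_vecMul_of_mulVec_col h] at this
  exact (mul_le_iff_le_one_left (ω.norm.pos one_ne_zero)).1 this

end Columns

/-! ### Pairs of conjugate elliptic points -/

/-- An elliptic point `ω` and its conjugate `ω'`, in terms of a ring `A` in a field `F` with a
finite field `k` of constants with `q` elements: they are the points `a + ε b` and `a + ε ^ q b`,
where `ε` generates the quadratic extension of `k` and is not in `F`, and `A ω + A` is stable under
multiplication by `ε`. -/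
structure EllipticPair (k : Type*) {F C A : Type*} [Field k] [Fintype k]
    [NontriviallyNormedField F] [NormedField C] [NormedAlgebra F C] [CommRing A]
    (f : A →+* F) (ω ω' : HalfPlane F C) where
  /-- the embedding of the constants -/
  ι : k →+* A
  injective : Function.Injective f
  exists_const : ∀ a, ‖f a‖ ≤ 1 → a ∈ Set.range ι
  norm_unit : ∀ u : Aˣ, ‖f u‖ = 1
  /-- the generator of the quadratic extension of `k` -/
  ε : C
  ε_pow : (ε ^ Fintype.card k) ^ Fintype.card k = ε
  ε_notMem : ε ∉ Set.range (algebraMap F C)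
  /-- the first coordinate of both points -/
  a : F
  /-- the coordinate of the points at `ε` and `ε ^ q` -/
  b : F
  b_ne_zero : b ≠ 0
  val_eq : ω.val = algebraMap F C a + ε * algebraMap F C b
  val_eq' : ω'.val = algebraMap F C a + ε ^ Fintype.card k * algebraMap F C b
  /-- the matrix of multiplication by `ε` -/
  Λ : Matrix (Fin 2) (Fin 2) A
  mulVec_col : (matC f C Λ).mulVec ω.col = ε • ω.col
  mulVec_col' : (matC f C Λ).mulVec ω'.col = ε ^ Fintype.card k • ω'.col

namespace EllipticPair

variable {k F C A : Type*} [Field k] [Fintype k] [NontriviallyNormedField F]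
  [NormedField C] [NormedAlgebra F C] [CommRing A] {f : A →+* F} {ω ω' : HalfPlane F C}
  (D : EllipticPair k f ω ω')

include D

/-- The embedding of the constants into `C`. -/
def ιC : k →+* C := ((algebraMap F C).comp f).comp D.ι

theorem ιC_apply (x : k) : D.ιC x = algebraMap F C (f (D.ι x)) := rfl

theorem ε_pow_ne : D.ε ^ Fintype.card k ≠ D.ε := by
  intro h
  obtain ⟨x, hx⟩ := (pow_card_eq_self_iff D.ιC).1 h
  exact D.ε_notMem ⟨f (D.ι x), hx⟩

theorem ε_pow_notMem : D.ε ^ Fintype.card k ∉ Set.range (algebraMap F C) := by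
  rintro ⟨x, hx⟩
  exact D.ε_notMem ⟨x ^ Fintype.card k, by rw [map_pow, hx, D.ε_pow]⟩

theorem val_ne : ω.val ≠ ω'.val := by
  rw [D.val_eq, D.val_eq']
  intro h
  have hb : algebraMap F C D.b ≠ 0 := by simpa using D.b_ne_zero
  exact D.ε_pow_ne (mul_right_cancel₀ hb (add_left_cancel h)).symm

/-- The eigenvalues at `ω` and `ω'` determine the characteristic polynomial. -/
theorem trace_det_eq {M : Matrix (Fin 2) (Fin 2) A} {μ μ' : C}
    (h : (matC f C M).mulVec ω.col = μ • ω.col) (h' : (matC f C M).mulVec ω'.col = μ' • ω'.col) :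
    algebraMap F C (f M.trace) = μ + μ' ∧ algebraMap F C (f M.det) = μ * μ' := by
  obtain ⟨h0, h1⟩ := matC_mulVec_col.1 h
  obtain ⟨h0', h1'⟩ := matC_mulVec_col.1 h'
  simp only [Pi.smul_apply, smul_eq_mul, HalfPlane.col_zero, HalfPlane.col_one,
    mul_one] at h0 h1 h0' h1'
  have hne := sub_ne_zero.2 D.val_ne
  rw [Matrix.trace_fin_two, Matrix.det_fin_two]
  simp only [map_add, map_sub, map_mul]
  constructor
  · apply mul_left_cancel₀ hne
    linear_combination h0 - h0' + ω.val * h1' - ω'.val * h1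
  · apply mul_left_cancel₀ hne
    linear_combination
      (algebraMap F C (f (M 1 0)) * ω'.val + algebraMap F C (f (M 1 1))) * h0 -
      (algebraMap F C (f (M 1 0)) * ω.val + algebraMap F C (f (M 1 1))) * h0' +
      μ * ω.val * h1' - μ' * ω'.val * h1

/-- The eigenspaces of `Λ` are spanned by the columns of `ω` and `ω'`. -/
theorem eq_smul_col {z : HalfPlane F C} {ε : C} (hε : ε ∉ Set.range (algebraMap F C))
    (hz : (matC f C D.Λ).mulVec z.col = ε • z.col) {w : Fin 2 → C}
    (hw : (matC f C D.Λ).mulVec w = ε • w) : w = w 1 • z.col := by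
  obtain ⟨-, h1⟩ := matC_mulVec_col.1 hz
  have h2 := congrFun hw 1
  simp only [Pi.smul_apply, smul_eq_mul, HalfPlane.col_one, mul_one] at h1
  simp only [matC, RingHom.mapMatrix_apply, Matrix.mulVec, dotProduct, Fin.sum_univ_two,
    Matrix.map_apply, Pi.smul_apply, smul_eq_mul, RingHom.comp_apply] at h2
  have hc : algebraMap F C (f (D.Λ 1 0)) ≠ 0 := by
    intro hc
    rw [hc, zero_mul, zero_add] at h1
    exact hε ⟨_, h1⟩
  ext i
  fin_cases i
  · apply mul_left_cancel₀ hc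
    simp only [Pi.smul_apply, smul_eq_mul, Fin.zero_eta, HalfPlane.col_zero]
    linear_combination h2 - w 1 * h1
  · simp

/-- Given a field with `q²` elements, there is an embedding of it into the matrices over `A`, by
elements with eigenvectors `ω` and `ω'`. -/
theorem exists_embedding {k₂ : Type*} [Field k₂] [Fintype k₂]
    (hcard : Fintype.card k₂ = Fintype.card k ^ 2) :
    ∃ (i : k₂ →+* C) (j : k₂ →+* Matrix (Fin 2) (Fin 2) A),
      (∀ z, (matC f C (j z)).mulVec ω.col = i z • ω.col) ∧
      (∀ z, (matC f C (j z)).mulVec ω'.col = i (z ^ Fintype.card k) • ω'.col) ∧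
      (∀ z, z ^ Fintype.card k = z → ∃ a : A, j z = Matrix.scalar (Fin 2) a) ∧
      ∃ l, i l = D.ε ∧ j l = D.Λ := by
  classical
  obtain ⟨φ, hφ⟩ := exists_frobenius D.ιC
  have hhφ : ∀ x, φ (D.ιC x) = D.ιC x := fun x => by rw [hφ, ← map_pow, FiniteField.pow_card]
  obtain ⟨i, hex, hεi⟩ := exists_quadratic_embedding D.ιC D.ε_pow D.ε_pow_ne hcard
  obtain ⟨lin, hlindef⟩ : ∃ lin : k × k → Matrix (Fin 2) (Fin 2) A, ∀ p, lin p =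
      Matrix.scalar (Fin 2) (D.ι p.1) + Matrix.scalar (Fin 2) (D.ι p.2) * D.Λ :=
    ⟨_, fun _ => rfl⟩
  have hsc : ∀ (a : A) (w : Fin 2 → C), (matC f C (Matrix.scalar (Fin 2) a)).mulVec w =
      algebraMap F C (f a) • w := by
    intro a w
    ext n
    fin_cases n <;> simp [matC, Matrix.mulVec, dotProduct]
  have hlin : ∀ p : k × k,
      (matC f C (lin p)).mulVec ω.col = (D.ιC p.1 + D.ε * D.ιC p.2) • ω.col := by
    intro p
    simp only [hlindef, map_add, map_mul, Matrix.add_mulVec, ← Matrix.mulVec_mulVec, hsc,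
      D.mulVec_col]
    rw [smul_smul, ← add_smul, ιC_apply, ιC_apply, mul_comm D.ε]
  have hlin' : ∀ p : k × k,
      (matC f C (lin p)).mulVec ω'.col = (D.ιC p.1 + D.ε * D.ιC p.2) ^ Fintype.card k • ω'.col := by
    intro p
    rw [← hφ, map_add φ, map_mul φ, hhφ, hhφ, hφ]
    simp only [hlindef, map_add, map_mul, Matrix.add_mulVec, ← Matrix.mulVec_mulVec, hsc,
      D.mulVec_col']
    rw [smul_smul, ← add_smul, ιC_apply, ιC_apply, mul_comm (D.ε ^ _)]
  choose c hc using hex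
  have heig : ∀ z, (matC f C (lin (c z))).mulVec ω.col = i z • ω.col := fun z => by
    rw [hlin, ← hc]
  have huniq : ∀ z M, (matC f C M).mulVec ω.col = i z • ω.col → lin (c z) = M := fun z M hM =>
    eq_of_matC_mulVec_col D.injective (ω := ω) (by rw [hM, heig])
  let j : k₂ →+* Matrix (Fin 2) (Fin 2) A :=
    { toFun := fun z => lin (c z)
      map_one' := huniq _ _ (by rw [map_one, map_one, Matrix.one_mulVec, one_smul])
      map_zero' := huniq _ _ (by rw [map_zero, map_zero, Matrix.zero_mulVec, zero_smul])
      map_add' := fun z w => huniq _ _ (by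
        rw [map_add, map_add, Matrix.add_mulVec, heig, heig, add_smul])
      map_mul' := fun z w => huniq _ _ (by
        rw [map_mul, map_mul, ← Matrix.mulVec_mulVec, heig, Matrix.mulVec_smul, heig, smul_smul,
          mul_comm]) }
  refine ⟨i, j, heig, fun z => ?_, fun z hz => ?_, ?_⟩
  · change (matC f C (lin (c z))).mulVec ω'.col = _
    rw [hlin', ← hc, map_pow]
  · have h1 : i z ^ Fintype.card k = i z := by rw [← map_pow, hz]
    obtain ⟨x, hx⟩ := (pow_card_eq_self_iff D.ιC).1 h1
    exact ⟨D.ι x, huniq _ _ (by rw [hsc, ← hx, ιC_apply])⟩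
  · obtain ⟨l, hl⟩ := hεi
    exact ⟨l, hl, huniq _ _ (by rw [D.mulVec_col, hl])⟩

end EllipticPair

namespace EllipticPair

section Contractions

variable {k F C A : Type*} [Field k] [Fintype k] [NontriviallyNormedField F]
  [NormedField C] [NormedAlgebra F C] [CommRing A] {f : A →+* F}
  {ω ω' : HalfPlane F C} (D : EllipticPair k f ω ω') [CompleteSpace F] [IsUltrametricDist C]

include D

theorem norm_eq_max (x : Fin 2 → F) :
    ω.norm.toFun x = max ‖x 0 * D.a + x 1‖ ‖x 0 * D.b‖ := by
  rw [← norm_add_mul_eq_max D.ιC D.ε_pow D.ε_notMem, HalfPlane.norm_apply, D.val_eq]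
  congr 1
  simp only [map_add, map_mul]; ring

/-- Conjugate points define the same norm. -/
theorem norm_conj_eq (x : Fin 2 → F) : ω'.norm.toFun x = ω.norm.toFun x := by
  rw [D.norm_eq_max, ← norm_add_mul_eq_max D.ιC (ε := D.ε ^ Fintype.card k) (by rw [D.ε_pow])
    D.ε_pow_notMem, HalfPlane.norm_apply, D.val_eq']
  congr 1
  simp only [map_add, map_mul]; ring

/-- A matrix that maps `ω'` to `ω` is a similitude of their common norm. -/
theorem norm_vecMul_of_interchange {M : Matrix (Fin 2) (Fin 2) A} {β : C}
    (h : (matC f C M).mulVec ω'.col = β • ω.col) (x : Fin 2 → F) :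
    ω.norm.toFun (Matrix.vecMul x (M.map f)) = ‖β‖ * ω.norm.toFun x := by
  rw [← D.norm_conj_eq, norm_vecMul_of_mulVec_col h]

/-- A matrix that multiplies the norm by at most `r` has determinant at most `r ^ 2`. -/
theorem norm_det_le {M : Matrix (Fin 2) (Fin 2) A} {r : ℝ} (hr : 0 ≤ r)
    (h : ∀ x, ω.norm.toFun (Matrix.vecMul x (M.map f)) ≤ r * ω.norm.toFun x) :
    ‖f M.det‖ ≤ r ^ 2 := by
  have hb : 0 < ‖D.b‖ := norm_pos_iff.2 D.b_ne_zero
  -- evaluate the linear forms given by `ω` and `ω'` at the basis that computes the norm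
  obtain ⟨T, hT⟩ : ∃ T : (Fin 2 → F) → HalfPlane F C → C, ∀ x z,
      T x z = algebraMap F C (Matrix.vecMul x (M.map f) 0) * z.val +
        algebraMap F C (Matrix.vecMul x (M.map f) 1) := ⟨_, fun _ _ => rfl⟩
  have hTn : ∀ x, ‖T x ω‖ ≤ r * ω.norm.toFun x := fun x => by rw [hT]; exact h x
  have hTn' : ∀ x, ‖T x ω'‖ ≤ r * ω.norm.toFun x := fun x => by
    refine le_trans (le_of_eq ?_) (h x)
    rw [hT, ← D.norm_conj_eq, HalfPlane.norm_apply]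
  have h0 : ω.norm.toFun ![1, -D.a] = ‖D.b‖ := by
    rw [D.norm_eq_max]; simp
  have h1 : ω.norm.toFun ![0, 1] = 1 := by
    rw [D.norm_eq_max]; simp
  have hdet : algebraMap F C (f M.det) * (ω.val - ω'.val) =
      T ![1, -D.a] ω * T ![0, 1] ω' - T ![1, -D.a] ω' * T ![0, 1] ω := by
    simp only [hT, Matrix.det_fin_two, Matrix.vecMul, dotProduct, Fin.sum_univ_two,
      Matrix.map_apply, map_add, map_sub, map_mul, Matrix.cons_val_zero, Matrix.cons_val_one,
      map_neg, map_one, map_zero]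
    ring
  have hdiff : ‖ω.val - ω'.val‖ = ‖D.b‖ := by
    have e : ω.val - ω'.val = (D.ε - D.ε ^ Fintype.card k) * algebraMap F C D.b := by
      rw [D.val_eq, D.val_eq']; ring
    have hne : D.ε - D.ε ^ Fintype.card k ≠ 0 := sub_ne_zero.2 D.ε_pow_ne.symm
    have hq := Fintype.one_lt_card (α := k)
    obtain ⟨φ, hφ⟩ := exists_frobenius D.ιC
    rw [e, norm_mul, norm_algebraMap',
      norm_eq_one_of_pow_eq_self (m := Fintype.card k * Fintype.card k) (by nlinarith) ?_ hne,
      one_mul]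
    have h2 : ∀ y, y ^ Fintype.card k = φ y := fun y => (hφ y).symm
    have h3 : φ (φ D.ε) = D.ε := by rw [hφ, hφ, D.ε_pow]
    simp only [pow_mul, h2, map_sub, h3]
  have hprod : ∀ z z' : HalfPlane F C, (∀ x, ‖T x z‖ ≤ r * ω.norm.toFun x) →
      (∀ x, ‖T x z'‖ ≤ r * ω.norm.toFun x) →
      ‖T ![1, -D.a] z * T ![0, 1] z'‖ ≤ r ^ 2 * ‖D.b‖ := by
    intro z z' hz hz'
    rw [norm_mul]
    refine (mul_le_mul (hz _) (hz' _) (norm_nonneg _)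
      (mul_nonneg hr (ω.norm.nonneg _))).trans (le_of_eq ?_)
    rw [h0, h1]; ring
  refine le_of_mul_le_mul_right ?_ hb
  rw [← hdiff, ← norm_algebraMap' C (f M.det), ← norm_mul, hdet, hdiff]
  rw [sub_eq_add_neg]
  refine (IsUltrametricDist.norm_add_le_max _ _).trans (max_le (hprod _ _ hTn hTn') ?_)
  rw [norm_neg]
  exact hprod _ _ hTn' hTn

/-- A similitude in `GL₂(A)` is an isometry, since its determinant is a unit. -/
theorem similitude_eq_one {g : GL (Fin 2) A} {r : ℝ} (hr : 0 < r)
    (h : ∀ x, ω.norm.toFun (Matrix.vecMul x (g.val.map f)) = r * ω.norm.toFun x) : r = 1 := by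
  have key : ∀ (g : GL (Fin 2) A) (r : ℝ), 0 < r →
      (∀ x, ω.norm.toFun (Matrix.vecMul x (g.val.map f)) = r * ω.norm.toFun x) → 1 ≤ r := by
    intro g r hr h
    have h1 := D.norm_det_le hr.le fun x => (h x).le
    have h2 : ‖f g.val.det‖ = 1 := D.norm_unit (Matrix.GeneralLinearGroup.det g)
    rw [h2] at h1
    nlinarith
  refine le_antisymm ?_ (key g r hr h)
  have := key g⁻¹ r⁻¹ (inv_pos.2 hr) (ω.norm.vecMul_inv hr h)
  exact (one_le_inv₀ hr).1 this

/-- The units of the ring of contractions are the stabilizer of the class of the norm. -/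
theorem exists_similitude_iff {g : GL (Fin 2) A} :
    (∃ r : ℝ, 0 < r ∧ ∀ x, ω.norm.toFun (Matrix.vecMul x (g.val.map f)) = r * ω.norm.toFun x) ↔
      g.val ∈ contractions f ω.norm ∧ g⁻¹.val ∈ contractions f ω.norm := by
  constructor
  · rintro ⟨r, hr, h⟩
    obtain rfl := D.similitude_eq_one hr h
    refine ⟨fun x => ?_, fun x => ?_⟩
    · rw [h, one_mul]
    · rw [ω.norm.vecMul_inv hr h, inv_one, one_mul]
  · rintro ⟨h, h'⟩
    refine ⟨1, one_pos, fun x => ?_⟩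
    rw [one_mul]
    refine le_antisymm (h x) ?_
    have := h' (Matrix.vecMul x (g.val.map f))
    have e := vecMul_map_inv f g⁻¹ x
    rw [inv_inv] at e
    rwa [e] at this

theorem norm_le_one_of_mem_contractions' {M : Matrix (Fin 2) (Fin 2) A} {μ : C}
    (hM : M ∈ contractions f ω.norm) (h : (matC f C M).mulVec ω'.col = μ • ω'.col) :
    ‖μ‖ ≤ 1 := by
  have := hM 1
  rw [← D.norm_conj_eq, ← D.norm_conj_eq, norm_vecMul_of_mulVec_col h, D.norm_conj_eq] at this
  exact (mul_le_iff_le_one_left (ω.norm.pos one_ne_zero)).1 this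

/-- The structure of the ring of contractions, a form of `H⁰` of the endomorphism bundle: it
contains the field `k₂` with `q²` elements, and is equal to it or to `k₂ ⊕ k₂ τ`. -/
theorem exists_structure {k₂ : Type*} [Field k₂] [Fintype k₂]
    (hcard : Fintype.card k₂ = Fintype.card k ^ 2) :
    ∃ j : k₂ →+* Matrix (Fin 2) (Fin 2) A,
      (∀ z, j z ∈ contractions f ω.norm) ∧
      (∀ z, ∃ μ : C, (matC f C (j z)).mulVec ω.col = μ • ω.col) ∧
      ((¬ ∃ g : GL (Fin 2) A, ω = Matrix.GeneralLinearGroup.map f g • ω') →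
        ∀ M ∈ contractions f ω.norm, ∃ z, M = j z) ∧
      ((∃ g : GL (Fin 2) A, ω = Matrix.GeneralLinearGroup.map f g • ω') →
        ∃ τ ∈ contractions f ω.norm, τ * τ = 1 ∧
          (∀ z, τ * j z = j (z ^ Fintype.card k) * τ) ∧
          (∀ z w, j z + j w * τ = 0 → z = 0 ∧ w = 0) ∧
          ∀ M ∈ contractions f ω.norm, ∃ z w, M = j z + j w * τ) := by
  obtain ⟨i, j, hj, hj', hscal, l, hl, hlΛ⟩ := D.exists_embedding hcard
  set q := Fintype.card k with hq
  have hq1 : 1 < q := Fintype.one_lt_card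
  have : Nontrivial A := f.domain_nontrivial
  have hpow2 : ∀ z : k₂, (z ^ q) ^ q = z := fun z => by
    rw [← pow_mul, ← pow_two, ← hcard, FiniteField.pow_card]
  obtain ⟨φ, hφ⟩ : ∃ φ : k₂ →+* k₂, ∀ z, φ z = z ^ q := by
    obtain ⟨φ, hφ⟩ := exists_frobenius D.ιC
    refine ⟨RingHom.mk (powMonoidHom q) (zero_pow (by omega)) fun x y => ?_, fun _ => rfl⟩
    apply i.injective
    change i ((x + y) ^ q) = i (x ^ q + y ^ q)
    rw [map_add, map_pow, map_pow, map_pow, map_add, ← hφ, ← hφ, ← hφ, map_add]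
  have hfix : ∀ z : k₂, z ^ q = z → ∀ M, j z * M = M * j z := by
    intro z hz M
    obtain ⟨a, ha⟩ := hscal z hz
    rw [ha]
    exact Matrix.scalar_commute a (Commute.all a) M
  have hcomm : ∀ z w, j z * j w = j w * j z := fun z w => by
    rw [← map_mul, mul_comm, map_mul]
  have hmem : ∀ z, j z ∈ contractions f ω.norm := by
    intro z
    refine mem_contractions_of_mulVec (hj z) ?_
    by_cases hz : z = 0
    · simp [hz]
    · refine (norm_eq_one_of_pow_eq_self (m := Fintype.card k₂) Fintype.one_lt_card ?_ ?_).le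
      · rw [← map_pow, FiniteField.pow_card]
      · exact (map_ne_zero i).2 hz
  -- contractions that commute with the elements of `k₂` are constants
  have hcentral : ∀ M ∈ contractions f ω.norm, j l * M = M * j l → ∃ z, M = j z := by
    intro M hM hl'
    obtain ⟨μ, hμ⟩ : ∃ μ : C, (matC f C M).mulVec ω.col = μ • ω.col := by
      refine ⟨_, D.eq_smul_col D.ε_notMem D.mulVec_col ?_⟩
      rw [← hlΛ, Matrix.mulVec_mulVec, ← map_mul, hl', map_mul, ← Matrix.mulVec_mulVec, hj,
        Matrix.mulVec_smul, hl]
    obtain ⟨μ', hμ'⟩ : ∃ μ : C, (matC f C M).mulVec ω'.col = μ • ω'.col := by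
      refine ⟨_, D.eq_smul_col D.ε_pow_notMem D.mulVec_col' ?_⟩
      rw [← hlΛ, Matrix.mulVec_mulVec, ← map_mul, hl', map_mul, ← Matrix.mulVec_mulVec, hj',
        Matrix.mulVec_smul, map_pow, hl]
    obtain ⟨ht, hn⟩ := D.trace_det_eq hμ hμ'
    have h1 := norm_le_one_of_mem_contractions hM hμ
    have h2 := D.norm_le_one_of_mem_contractions' hM hμ'
    obtain ⟨t, ht'⟩ := D.exists_const M.trace (by
      rw [← norm_algebraMap' C, ht]
      exact (IsUltrametricDist.norm_add_le_max _ _).trans (max_le h1 h2))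
    obtain ⟨n, hn'⟩ := D.exists_const M.det (by
      rw [← norm_algebraMap' C, hn, norm_mul]
      exact mul_le_one₀ h1 (norm_nonneg _) h2)
    have hroot : μ ^ 2 - D.ιC t * μ + D.ιC n = 0 := by
      rw [ιC_apply, ιC_apply, ht', hn', ht, hn]; ring
    obtain ⟨z, hz⟩ : μ ∈ Set.range i := by
      rw [← pow_card_eq_self_iff, hcard, pow_two, pow_mul]
      by_cases hr : μ ∈ Set.range D.ιC
      · rw [← pow_card_eq_self_iff] at hr
        rw [hr, hr]
      · exact (pow_card_eq_other_root D.ιC hroot hr).2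
    refine ⟨z, eq_of_matC_mulVec_col D.injective (ω := ω) ?_⟩
    rw [hμ, hj, hz]
  have hlne : l - l ^ q ≠ 0 := by
    intro h
    apply D.ε_pow_ne
    rw [← hl, ← map_pow, ← sub_eq_zero.1 h]
  have htr : ∀ M, (j l + j (l ^ q)) * M = M * (j l + j (l ^ q)) := by
    intro M
    rw [← map_add]
    refine hfix _ ?_ M
    rw [← hφ, map_add, hφ, hφ, hpow2, add_comm]
  have hnm : ∀ M, j l * j (l ^ q) * M = M * (j l * j (l ^ q)) := by
    intro M
    rw [← map_mul]
    refine hfix _ ?_ M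
    rw [mul_pow, hpow2, mul_comm]
  -- every contraction is the sum of a constant and of a semilinear contraction
  have hdec : ∀ M ∈ contractions f ω.norm, ∃ z, ∃ N ∈ contractions f ω.norm,
      M = j z + N ∧ N * j l = j (l ^ q) * N := by
    intro M hM
    obtain ⟨h1, h2⟩ := conj_decomposition (l := j l) (l' := j (l ^ q))
      (d := j ((l - l ^ q)⁻¹)) (M := M) (hcomm _ _)
      (by rw [← map_sub, ← map_mul, inv_mul_cancel₀ hlne, map_one]) (hcomm _ _) (hcomm _ _)
      (htr M) (hnm M)
    have h3 : j ((l - l ^ q)⁻¹) * (M * j l - j (l ^ q) * M) ∈ contractions f ω.norm :=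
      mul_mem (hmem _) (sub_mem (mul_mem hM (hmem _)) (mul_mem (hmem _) hM))
    obtain ⟨z, hz⟩ := hcentral _ h3 h1
    exact ⟨z, _, sub_mem hM h3, by rw [← hz]; abel, h2⟩
  have hflip : ∀ N, N * j l = j (l ^ q) * N → j l * N = N * j (l ^ q) := by
    intro N hN
    have := htr N
    rw [add_mul, mul_add, hN, add_comm] at this
    exact add_left_cancel this
  refine ⟨j, hmem, fun z => ⟨_, hj z⟩, fun hne M hM => ?_, ?_⟩
  · obtain ⟨z, N, hN, rfl, hNl⟩ := hdec M hM
    refine ⟨z, ?_⟩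
    rw [add_eq_left]
    by_contra hN0
    have hlN := hflip N hNl
    -- a nonzero semilinear contraction interchanges the two points and is invertible
    obtain ⟨β, hβ⟩ : ∃ β : C, (matC f C N).mulVec ω'.col = β • ω.col := by
      refine ⟨_, D.eq_smul_col D.ε_notMem D.mulVec_col ?_⟩
      rw [← hlΛ, Matrix.mulVec_mulVec, ← map_mul, hlN, map_mul, ← Matrix.mulVec_mulVec, hj',
        Matrix.mulVec_smul, hpow2, hl]
    obtain ⟨β', hβ'⟩ : ∃ β : C, (matC f C N).mulVec ω.col = β • ω'.col := by
      refine ⟨_, D.eq_smul_col D.ε_pow_notMem D.mulVec_col' ?_⟩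
      rw [← hlΛ, Matrix.mulVec_mulVec, ← map_mul, hlN, map_mul, ← Matrix.mulVec_mulVec, hj,
        Matrix.mulVec_smul, map_pow, hl]
    have hβ0 : β ≠ 0 := by
      rintro rfl
      exact hN0 (eq_zero_of_matC_mulVec_col D.injective (ω := ω') (by rw [hβ, zero_smul]))
    have hβ0' : β' ≠ 0 := by
      rintro rfl
      exact hN0 (eq_zero_of_matC_mulVec_col D.injective (ω := ω) (by rw [hβ', zero_smul]))
    obtain ⟨n, hn⟩ := hcentral (N * N) (mul_mem hN hN) (by
      rw [← mul_assoc, hlN, mul_assoc, ← hNl, mul_assoc])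
    have hn0 : n ≠ 0 := by
      rintro rfl
      rw [map_zero] at hn
      have h1 : (matC f C (N * N)).mulVec ω.col = (β' * β) • ω.col := by
        rw [map_mul, ← Matrix.mulVec_mulVec, hβ', Matrix.mulVec_smul, hβ, smul_smul]
      rw [hn, map_zero, Matrix.zero_mulVec] at h1
      have h2 := congrFun h1 1
      simp only [Pi.zero_apply, Pi.smul_apply, HalfPlane.col_one, smul_eq_mul, mul_one] at h2
      exact mul_ne_zero hβ0' hβ0 h2.symm
    have hnn : j n * j n⁻¹ = 1 := by rw [← map_mul, mul_inv_cancel₀ hn0, map_one]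
    have hr : N * (N * j n⁻¹) = 1 := by rw [← mul_assoc, hn, hnn]
    let g : GL (Fin 2) A := ⟨N, N * j n⁻¹, hr, mul_eq_one_comm.1 hr⟩
    exact hne ⟨g, ((map_smul_eq_iff g ω ω').2 ⟨β, hβ0, hβ⟩).symm⟩
  · rintro ⟨g, hg⟩
    obtain ⟨β, hβ0, hβ⟩ := (map_smul_eq_iff g ω ω').1 hg.symm
    obtain ⟨hgm, hgm'⟩ := D.exists_similitude_iff.1
      ⟨‖β‖, norm_pos_iff.2 hβ0, D.norm_vecMul_of_interchange hβ⟩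
    have hgj : ∀ z, g.val * j z = j (z ^ q) * g.val := by
      intro z
      refine eq_of_matC_mulVec_col D.injective (ω := ω') ?_
      rw [map_mul, map_mul, ← Matrix.mulVec_mulVec, ← Matrix.mulVec_mulVec, hj', hβ,
        Matrix.mulVec_smul, Matrix.mulVec_smul, hj, hβ, smul_comm]
    obtain ⟨n, hn⟩ := hcentral (g.val * g.val) (mul_mem hgm hgm) (by
      rw [mul_assoc g.val g.val (j l), hgj l, ← mul_assoc g.val (j _), hgj, hpow2, mul_assoc])
    have hgu : g.val * g⁻¹.val = 1 := Units.mul_inv g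
    have hn0 : n ≠ 0 := by
      rintro rfl
      rw [map_zero] at hn
      have h1 : g.val * g.val * (g⁻¹.val * g⁻¹.val) = 1 := by
        rw [mul_assoc, ← mul_assoc g.val g⁻¹.val, hgu, one_mul, hgu]
      rw [hn, zero_mul] at h1
      exact zero_ne_one h1
    have hnq : n ^ q = n := by
      apply j.injective
      have h1 : j (n ^ q) * g.val = j n * g.val := by
        rw [← hgj, ← hn, mul_assoc]
      exact (Units.mul_left_inj g).1 h1
    obtain ⟨c, hc⟩ := exists_norm_eq hcard (n := n⁻¹) (by rw [inv_pow, ← hq, hnq])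
      (inv_ne_zero hn0)
    rw [← hq] at hc
    have hτ : j c * g.val * (j c * g.val) = 1 := by
      rw [mul_assoc, ← mul_assoc g.val, hgj, mul_assoc (j _), hn, ← map_mul, ← map_mul,
        ← mul_assoc, hc, inv_mul_cancel₀ hn0, map_one]
    have hτj : ∀ z, j c * g.val * j z = j (z ^ q) * (j c * g.val) := by
      intro z
      rw [mul_assoc, hgj, ← mul_assoc, hcomm, mul_assoc]
    have hτm : j c * g.val ∈ contractions f ω.norm := mul_mem (hmem c) hgm
    set τ := j c * g.val
    clear_value τ
    refine ⟨τ, hτm, hτ, hτj, fun z w h => ?_, fun M hM => ?_⟩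
    · -- compare the products with `l` from the left and with its conjugate from the right
      have h1 : j (z * (l - l ^ q)) = (j z + j w * τ) * j l - j (l ^ q) * (j z + j w * τ) := by
        have e1 : j w * τ * j l = j (l ^ q) * (j w * τ) := by
          rw [mul_assoc, hτj, ← mul_assoc, hcomm, mul_assoc]
        rw [add_mul, mul_add, e1, hcomm (l ^ q) z, ← map_mul, ← map_mul, mul_sub, map_sub]
        abel
      rw [h, zero_mul, mul_zero, sub_zero, map_eq_zero] at h1
      have hz : z = 0 := (mul_eq_zero.1 h1).resolve_right hlne
      refine ⟨hz, ?_⟩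
      rw [hz, map_zero, zero_add] at h
      have h2 : j w = 0 := by
        rw [← mul_one (j w), ← hτ, ← mul_assoc, h, zero_mul]
      exact (map_eq_zero j).1 h2
    · obtain ⟨z, N, hN, rfl, hNl⟩ := hdec M hM
      have hlN := hflip N hNl
      obtain ⟨w, hw⟩ := hcentral (N * τ) (mul_mem hN hτm) (by
        rw [← mul_assoc, hlN, mul_assoc, ← hτj, mul_assoc])
      refine ⟨z, w, ?_⟩
      rw [← hw, mul_assoc, hτ, mul_one]

end Contractions

end EllipticPair

/-! ### The stabilizers of an elliptic point and of its vertex -/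

section Stabilizers

theorem exists_ringHom_of_card_eq_sq {k k₂ : Type*} [Field k] [Fintype k] [Field k₂] [Fintype k₂]
    (hcard : Fintype.card k₂ = Fintype.card k ^ 2) : Nonempty (k →+* k₂) := by
  obtain ⟨p, hp⟩ := CharP.exists k
  have : Fact p.Prime := ⟨CharP.char_is_prime k p⟩
  have := Fintype.ofFinite (FiniteField.Extension k p 2)
  have h : Fintype.card (FiniteField.Extension k p 2) = Fintype.card k₂ := by
    rw [hcard, ← Nat.card_eq_fintype_card, ← Nat.card_eq_fintype_card,
      FiniteField.natCard_extension]
  exact ⟨(FiniteField.ringEquivOfCardEq h).toRingHom.comp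
    (algebraMap k (FiniteField.Extension k p 2))⟩

variable {k F C A : Type*} [Field k] [Fintype k] [NontriviallyNormedField F]
  [NormedField C] [NormedAlgebra F C] [CommRing A] {f : A →+* F}
  {ω ω' : HalfPlane F C} [CompleteSpace F] [IsUltrametricDist C]

/-- The stabilizers of an elliptic point and of its vertex, the latter being described as the group
of all similitudes of the norm of the point. -/
theorem EllipticPair.stabilizers (D : EllipticPair k f ω ω') {k₂ : Type*} [Field k₂] [Fintype k₂]
    (hcard : Fintype.card k₂ = Fintype.card k ^ 2) {Gω Gv : Subgroup (GL (Fin 2) A)}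
    (hGω : ∀ g, g ∈ Gω ↔ Matrix.GeneralLinearGroup.map f g • ω = ω)
    (hGv : ∀ g : GL (Fin 2) A, g ∈ Gv ↔ ∃ r : ℝ, 0 < r ∧
      ∀ x, ω.norm.toFun (Matrix.vecMul x (g.val.map f)) = r * ω.norm.toFun x) :
    ((¬ ∃ g : GL (Fin 2) A, ω = Matrix.GeneralLinearGroup.map f g • ω') →
      Gv = Gω ∧ Nonempty (Gω ≃* k₂ˣ) ∧ Nat.card Gv = Fintype.card k ^ 2 - 1) ∧
    ((∃ g : GL (Fin 2) A, ω = Matrix.GeneralLinearGroup.map f g • ω') →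
      Nonempty (Gv ≃* GL (Fin 2) k) ∧
      Nat.card Gv = Fintype.card k * (Fintype.card k - 1) ^ 2 * (Fintype.card k + 1)) := by
  classical
  obtain ⟨j, hjm, hjω, h1, h2⟩ := D.exists_structure hcard
  have : Nontrivial A := f.domain_nontrivial
  have hGv' : ∀ g : GL (Fin 2) A, g ∈ Gv ↔
      g.val ∈ contractions f ω.norm ∧ g⁻¹.val ∈ contractions f ω.norm := fun g => by
    rw [hGv, D.exists_similitude_iff]
  constructor
  · intro hne
    have hj0 : ∀ z, ∀ g : GL (Fin 2) A, g.val = j z → z ≠ 0 := by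
      rintro z g hg rfl
      rw [map_zero] at hg
      exact g.ne_zero hg
    let U : k₂ˣ →* GL (Fin 2) A := Units.map j.toMonoidHom
    have hU : Function.Injective U := Units.map_injective j.injective
    have hrange : U.range = Gv := by
      ext g
      rw [hGv']
      constructor
      · rintro ⟨z, rfl⟩
        exact ⟨hjm _, by rw [← map_inv]; exact hjm _⟩
      · rintro ⟨hg, -⟩
        obtain ⟨z, hz⟩ := h1 hne _ hg
        exact ⟨Units.mk0 z (hj0 z g hz), Units.ext hz.symm⟩
    have heq : Gv = Gω := by
      ext g
      rw [hGω, map_smul_eq_iff]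
      constructor
      · intro hg
        obtain ⟨z, rfl⟩ : g ∈ U.range := by rwa [hrange]
        obtain ⟨μ, hμ⟩ := hjω z
        refine ⟨μ, ?_, hμ⟩
        rintro rfl
        rw [zero_smul] at hμ
        exact (U z).ne_zero (eq_zero_of_matC_mulVec_col D.injective hμ)
      · rintro ⟨β, hβ0, hβ⟩
        rw [hGv]
        exact ⟨‖β‖, norm_pos_iff.2 hβ0, norm_vecMul_of_mulVec_col hβ⟩
    have e : k₂ˣ ≃* Gv := (MonoidHom.ofInjective hU).trans (MulEquiv.subgroupCongr hrange)
    refine ⟨heq, heq ▸ ⟨e.symm⟩, ?_⟩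
    rw [← Nat.card_congr e.toEquiv, Nat.card_eq_fintype_card, Fintype.card_units, hcard]
  · intro hex
    obtain ⟨τ, hτm, hτ, hτj, hind, hspan⟩ := h2 hex
    obtain ⟨e⟩ := exists_ringHom_of_card_eq_sq hcard
    let := e.toAlgebra
    have hmem : ∀ M, M ∈ contractions f ω.norm ↔ ∃ z w, M = j z + j w * τ := by
      refine fun M => ⟨hspan M, ?_⟩
      rintro ⟨z, w, rfl⟩
      exact add_mem (hjm z) (mul_mem (hjm w) hτm)
    obtain ⟨E⟩ := units_mulEquiv_GL (k := k) hcard j hτ hτj hind Gv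
      fun u => by rw [hGv', hmem, hmem]
    refine ⟨⟨E⟩, ?_⟩
    rw [Nat.card_congr E.toEquiv, Matrix.card_GL_field, Fin.prod_univ_two]
    obtain ⟨s, hs⟩ := Nat.exists_eq_add_of_lt (Fintype.one_lt_card (α := k))
    have h3 : (1 + s + 1) ^ 2 - 1 = (s + 1) * (s + 3) :=
      (Nat.sub_eq_iff_eq_add (by nlinarith)).2 (by ring)
    have h4 : (1 + s + 1) ^ 2 - (1 + s + 1) = (s + 2) * (s + 1) :=
      (Nat.sub_eq_iff_eq_add (by nlinarith)).2 (by ring)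
    have h5 : 1 + s + 1 - 1 = s + 1 := by omega
    rw [hs, Fin.val_zero, Fin.val_one, pow_zero, pow_one, h3, h4, h5]
    ring

/-- A point whose stabilizer contains a matrix that is not scalar is one of a pair of conjugate
elliptic points: the eigenvalue of the matrix generates a quadratic extension of the constant
field. -/
theorem exists_ellipticPair (ι : k →+* A) (hf : Function.Injective f)
    (hconst : ∀ a, ‖f a‖ ≤ 1 → a ∈ Set.range ι) (hunit : ∀ u : Aˣ, ‖f u‖ = 1)
    {g : GL (Fin 2) A} (hg : Matrix.GeneralLinearGroup.map f g • ω = ω)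
    (hns : ¬ ∃ a : A, g.val = Matrix.scalar (Fin 2) a) :
    ∃ (ω' : HalfPlane F C) (D : EllipticPair k f ω ω'),
      D.a = -(f (g 1 1) / f (g 1 0)) ∧ D.b = 1 / f (g 1 0) := by
  obtain ⟨ε, -, hε⟩ := (map_smul_eq_iff g ω ω).1 hg
  obtain ⟨h0, h1⟩ := matC_mulVec_col.1 hε
  simp only [Pi.smul_apply, smul_eq_mul, HalfPlane.col_zero, HalfPlane.col_one, mul_one] at h0 h1
  have hc : f (g 1 0) ≠ 0 := by
    intro hc
    apply hns
    rw [hc, map_zero, zero_mul, zero_add] at h1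
    have h2 : algebraMap F C (f (g 0 0 - g 1 1)) * ω.val + algebraMap F C (f (g 0 1)) = 0 := by
      simp only [map_sub]
      rw [← h1] at h0
      linear_combination h0
    obtain ⟨h3, h4⟩ := ω.eq_zero h2
    have h5 := hf (h3.trans (map_zero f).symm)
    have h6 := hf (h4.trans (map_zero f).symm)
    have h7 := hf (hc.trans (map_zero f).symm)
    refine ⟨g 1 1, ?_⟩
    ext m n
    fin_cases m <;> fin_cases n
    · simpa using sub_eq_zero.1 h5
    · simpa using h6
    · simpa using h7
    · simp
  have hcC : algebraMap F C (f (g 1 0)) ≠ 0 := by simpa using hc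
  have hεF : ε ∉ Set.range (algebraMap F C) := by
    rintro ⟨x, hx⟩
    have h2 : algebraMap F C (f (g 1 0)) * ω.val + algebraMap F C (f (g 1 1) - x) = 0 := by
      rw [map_sub, hx]; linear_combination h1
    exact hc (ω.eq_zero h2).1
  have hroot' : ε ^ 2 - (algebraMap F C (f (g 0 0)) + algebraMap F C (f (g 1 1))) * ε +
      (algebraMap F C (f (g 0 0)) * algebraMap F C (f (g 1 1)) -
        algebraMap F C (f (g 0 1)) * algebraMap F C (f (g 1 0))) = 0 := by
    linear_combination -algebraMap F C (f (g 1 0)) * h0 +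
      (algebraMap F C (f (g 0 0)) - ε) * h1
  have hroot : ε ^ 2 - algebraMap F C (f g.val.trace) * ε + algebraMap F C (f g.val.det) = 0 := by
    rw [Matrix.trace_fin_two, Matrix.det_fin_two]
    simpa only [map_add, map_sub, map_mul] using hroot'
  have hdet : ‖f g.val.det‖ = 1 := hunit (Matrix.GeneralLinearGroup.det g)
  obtain ⟨n, hn⟩ := hconst _ hdet.le
  -- otherwise the eigenvalue would lie in `F`
  obtain ⟨t, ht⟩ := hconst g.val.trace (by
    by_contra hlt
    exact hεF (mem_range_of_one_lt_norm_trace hroot (not_le.1 hlt) hdet))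
  rw [← hn, ← ht] at hroot
  have hεk : ε ∉ Set.range (((algebraMap F C).comp f).comp ι) := by
    rintro ⟨x, hx⟩
    exact hεF ⟨_, hx⟩
  obtain ⟨hq, hqq⟩ := pow_card_eq_other_root (((algebraMap F C).comp f).comp ι) hroot hεk
  have hq' : ε ^ Fintype.card k = algebraMap F C (f (g 0 0)) + algebraMap F C (f (g 1 1)) - ε := by
    rw [hq]
    change algebraMap F C (f (ι t)) - ε = _
    rw [ht, Matrix.trace_fin_two, map_add, map_add]
  obtain ⟨w, hwdef⟩ : ∃ w : C, w = algebraMap F C (-(f (g 1 1) / f (g 1 0))) +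
    ε ^ Fintype.card k * algebraMap F C (1 / f (g 1 0)) := ⟨_, rfl⟩
  have hw : algebraMap F C (f (g 1 0)) * w + algebraMap F C (f (g 1 1)) = ε ^ Fintype.card k := by
    simp only [hwdef, map_neg, map_div₀, map_one]
    field_simp
    ring
  have hwF : w ∉ Set.range (algebraMap F C) := by
    rintro ⟨x, hx⟩
    refine hεF ⟨f (g 0 0) - f (g 1 0) * x, ?_⟩
    rw [← hx, hq'] at hw
    rw [map_sub, map_mul]
    linear_combination -hw
  obtain ⟨ω', rfl⟩ : ∃ ω' : HalfPlane F C, ω'.val = w := ⟨⟨w, hwF⟩, rfl⟩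
  refine ⟨ω', ⟨ι, hf, hconst, hunit, ε, hqq, hεF, _, _, one_div_ne_zero hc, ?_, hwdef,
    g.val, hε, ?_⟩, rfl, rfl⟩
  · simp only [map_neg, map_div₀, map_one]
    field_simp
    linear_combination h1
  · rw [matC_mulVec_col]
    simp only [Pi.smul_apply, smul_eq_mul, HalfPlane.col_zero, HalfPlane.col_one, mul_one]
    refine ⟨?_, hw⟩
    apply mul_left_cancel₀ hcC
    rw [hq'] at hw ⊢
    linear_combination (ε - algebraMap F C (f (g 1 1))) * hw - hroot'

end Stabilizers

/-! ### Elliptic points of Drinfeld's upper half-plane -/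

namespace Place

variable {k K : Type*} [Field k] [Fintype k] [Field K] [Algebra k K] (P : Place K)

theorem abs_discrete {x y : K} (h : P.abs x < P.abs y) : 2 * P.abs x ≤ P.abs y := by
  rw [abs_apply, abs_apply] at *
  have hm := WithZeroMulInt.toNNReal_strictMono (one_lt_two : (1 : ℝ≥0) < 2)
  rw [NNReal.coe_lt_coe, hm.lt_iff_lt] at h
  have h2 : WithZeroMulInt.toNNReal (two_ne_zero : (2 : ℝ≥0) ≠ 0) (WithZero.exp (1 : ℤ)) = 2 := by
    rw [WithZeroMulInt.toNNReal_neg_apply _ WithZero.exp_ne_zero]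
    exact zpow_one _
  have h3 : WithZero.exp (1 : ℤ) * P.valuation x ≤ P.valuation y := by
    by_cases hx : P.valuation x = 0
    · rw [hx, mul_zero]; exact zero_le
    · have hy : P.valuation y ≠ 0 := by
        intro hy; rw [hy] at h; exact absurd h not_lt_zero
      rw [← WithZero.exp_log hx, ← WithZero.exp_log hy, WithZero.exp_lt_exp] at h
      rw [← WithZero.exp_log hx, ← WithZero.exp_log hy, ← WithZero.exp_add, WithZero.exp_le_exp]
      omega
  have h4 := hm.monotone h3
  rw [map_mul, h2] at h4
  exact_mod_cast h4

/-- The absolute value of the completion is discrete, as `K` is dense. -/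
theorem norm_discrete (x y : P.Kinf) (h : ‖x‖ < ‖y‖) : 2 * ‖x‖ ≤ ‖y‖ := by
  have happ : ∀ z : P.Kinf, z ≠ 0 → ∃ a : K, P.abs a = ‖z‖ := by
    intro z hz
    have hd : DenseRange (UniformSpace.Completion.coe' : WithAbs P.abs → P.Kinf) :=
      UniformSpace.Completion.denseRange_coe
    obtain ⟨a, ha⟩ := Metric.denseRange_iff.1 hd z ‖z‖ (norm_pos_iff.2 hz)
    refine ⟨(WithAbs.equiv P.abs) a, ?_⟩
    rw [← norm_toKinf]
    change ‖(UniformSpace.Completion.coe' a : P.Kinf)‖ = _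
    rw [dist_eq_norm] at ha
    have h1 := IsUltrametricDist.norm_add_eq_max_of_norm_ne_norm (x := z)
      (y := -(z - (a : P.Kinf))) (by rw [norm_neg]; exact ha.ne')
    rw [norm_neg, max_eq_left ha.le, ← sub_eq_add_neg, sub_sub_cancel] at h1
    exact h1
  by_cases hx : x = 0
  · rw [hx, norm_zero, mul_zero]; exact norm_nonneg y
  · obtain ⟨a, ha⟩ := happ x hx
    obtain ⟨b, hb⟩ := happ y (by
      rintro rfl
      rw [norm_zero] at h
      exact absurd h (norm_nonneg x).not_gt)
    rw [← ha, ← hb] at h ⊢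
    exact P.abs_discrete h

/-- The embedding of the constants into `A`. -/
def constA : k →+* P.ringA :=
  (algebraMap k K).codRestrict P.ringA fun a =>
    P.mem_ringA.2 fun O _ => algebraMap_mem_valuationSubring O a

/-- The embedding of `A` into the completion. -/
abbrev ringAToKinf : P.ringA →+* P.Kinf := P.toKinf.comp P.ringA.subtype

theorem norm_ringAToKinf (a : P.ringA) : ‖P.ringAToKinf a‖ = P.abs a := P.norm_toKinf a

theorem exists_ellipticPair (hconst : ∀ x : K, IsAlgebraic k x → x ∈ Set.range (algebraMap k K))
    {ω : P.Omega} (hω : P.IsElliptic ω) :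
    ∃ (ω' : P.Omega) (_ : EllipticPair k P.ringAToKinf ω ω'),
      P.IsConjugate (Fintype.card k) ω ω' := by
  obtain ⟨g, hg, hns⟩ := hω
  obtain ⟨ω', D, ha, hb⟩ := DrinfeldModular.exists_ellipticPair (k := k) (f := P.ringAToKinf)
    (ω := ω) P.constA (P.toKinf.injective.comp Subtype.val_injective)
    (fun a h => by
      rw [P.norm_ringAToKinf] at h
      obtain ⟨c, hc⟩ := hconst _ (P.isAlgebraic_of_abs_le_one (k := k) a.2 h)
      exact ⟨c, Subtype.ext hc⟩)
    (fun u => by rw [P.norm_ringAToKinf]; exact P.abs_unit hconst u) hg hns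
  refine ⟨ω', D, D.ε, ?_, D.ε_pow_ne, -(((g 1 1 : P.ringA) : K) / ((g 1 0 : P.ringA) : K)),
    1 / ((g 1 0 : P.ringA) : K), ?_, ?_⟩
  · rw [pow_two, pow_mul, D.ε_pow]
  · rw [D.val_eq, ha, hb]
    simp [toCinf]
  · rw [D.val_eq', ha, hb]
    simp [toCinf]

/-- The trace and the norm of an element of `𝔽_{q²} K` lie in `K`. -/
theorem IsConjugate.exists_trace_norm {P : Place K} {ω ω' : P.Omega}
    (h : P.IsConjugate (Fintype.card k) ω ω') : ∃ t n : K,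
      ω.val + ω'.val = P.toCinf t ∧ ω.val * ω'.val = P.toCinf n := by
  obtain ⟨ε, hε, -, a, b, h1, h2⟩ := h
  obtain ⟨φ, hφ⟩ := exists_frobenius (P.toCinf.comp (algebraMap k K))
  have h3 : φ (φ ε) = ε := by rw [hφ, hφ, ← pow_mul, ← pow_two, hε]
  obtain ⟨t, ht⟩ := (pow_card_eq_self_iff (P.toCinf.comp (algebraMap k K))
    (x := ε + ε ^ Fintype.card k)).1 (by
    rw [← hφ, ← hφ, map_add, h3, add_comm])
  obtain ⟨n, hn⟩ := (pow_card_eq_self_iff (P.toCinf.comp (algebraMap k K))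
    (x := ε * ε ^ Fintype.card k)).1 (by
    rw [← hφ, ← hφ, map_mul, h3, mul_comm])
  rw [RingHom.comp_apply] at ht hn
  refine ⟨2 * a + algebraMap k K t * b,
    a ^ 2 + algebraMap k K t * a * b + algebraMap k K n * b ^ 2, ?_, ?_⟩
  · rw [h1, h2]
    simp only [map_add, map_mul, map_ofNat, ht]; ring
  · rw [h1, h2]
    simp only [map_add, map_mul, map_pow, ht, hn]; ring

theorem IsConjugate.unique {P : Place K} {ω ω' ω'' : P.Omega}
    (h : P.IsConjugate (Fintype.card k) ω ω') (h' : P.IsConjugate (Fintype.card k) ω ω'') :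
    ω' = ω'' := by
  obtain ⟨t, n, ht, hn⟩ := h.exists_trace_norm
  obtain ⟨t', n', ht', hn'⟩ := h'.exists_trace_norm
  -- two quadratic equations with the root `ω` are equal, since `ω` is not in `K`
  have h1 : algebraMap P.Kinf P.Cinf (P.toKinf (t - t')) * ω.val +
      algebraMap P.Kinf P.Cinf (P.toKinf (n' - n)) = 0 := by
    change P.toCinf (t - t') * ω.val + P.toCinf (n' - n) = 0
    rw [map_sub, map_sub, ← ht, ← ht', ← hn, ← hn']; ring
  have h2 : t = t' := sub_eq_zero.1 ((map_eq_zero P.toKinf).1 (ω.eq_zero h1).1)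
  apply HalfPlane.ext
  rw [h2, ← ht'] at ht
  exact add_left_cancel ht

end Place

end DrinfeldModular

end

theorem proposition3p4
    {Fq K : Type*} [Field Fq] [Fintype Fq] [Field K]
    [Algebra Fq K] [Algebra (RatFunc Fq) K] [IsScalarTower Fq (RatFunc Fq) K] [FunctionField Fq K]
    (hconst : ∀ x : K, IsAlgebraic Fq x → x ∈ Set.range (algebraMap Fq K))
    (P : DrinfeldModular.Place K)
    {Fq2 : Type*} [Field Fq2] [Fintype Fq2] (hFq2 : Fintype.card Fq2 = Fintype.card Fq ^ 2)
    (ω : P.Omega) (hω : P.IsElliptic ω) :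
    (∃! ω' : P.Omega, P.IsConjugate (Fintype.card Fq) ω ω') ∧
    (∃! v : DrinfeldModular.Vertex P.Kinf, DrinfeldModular.buildingMap ω = v.toPoint) ∧
    ∀ (ω' : P.Omega) (v : DrinfeldModular.Vertex P.Kinf),
      P.IsConjugate (Fintype.card Fq) ω ω' → DrinfeldModular.buildingMap ω = v.toPoint →
      (¬ P.Equivalent ω ω' →
        P.vertexStabilizer v = P.pointStabilizer ω ∧
        Nonempty (P.pointStabilizer ω ≃* Fq2ˣ) ∧
        Nat.card (P.vertexStabilizer v) = Fintype.card Fq ^ 2 - 1) ∧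
      (P.Equivalent ω ω' →
        Nonempty (P.vertexStabilizer v ≃* GL (Fin 2) Fq) ∧
        Nat.card (P.vertexStabilizer v) =
          Fintype.card Fq * (Fintype.card Fq - 1) ^ 2 * (Fintype.card Fq + 1)) := by
  obtain ⟨ω₁, D, hconj⟩ := P.exists_ellipticPair hconst hω
  have huniq : ∀ ω', P.IsConjugate (Fintype.card Fq) ω ω' → ω' = ω₁ := fun ω' h =>
    h.unique hconj
  refine ⟨⟨ω₁, hconj, huniq⟩, ?_, fun ω' v h hv => ?_⟩
  · obtain ⟨v, hv⟩ := ω.exists_vertex D.b_ne_zero D.norm_eq_max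
    exact ⟨v, hv, fun v' hv' =>
      DrinfeldModular.Vertex.toPoint_injective P.norm_discrete (hv'.symm.trans hv)⟩
  · obtain rfl := huniq ω' h
    exact D.stabilizers hFq2 (fun g => Iff.rfl)
      (fun g => DrinfeldModular.HalfPlane.smul_vertex_eq_iff P.norm_discrete hv (P.embG g))
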